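/- Let $G$ be a locally compact second countable (Hausdorff) group with right Haar measure $\lambda$, and let $\rho$ be a probability measure on $G$ with the same null sets as $\lambda$. Let $\Gamma$ be a countable subgroup of $G$ and $\mu$ a probability measure on $\Gamma$ whose support generates $\Gamma$ as a semigroup. Definitions. All functions are real-valued. Let $H$ be a locally compact second countable group with right Haar measure $\lambda_H$ (the counting measure if $H$ is countable and regarded as discrete) and $\mu_H$ a probability measure on $H$. Let $H^\infty_{\lambda_H}(H)$ be the space of $f\in L^\infty(H,\lambda_H)$ with $f(h)=\int f(hk)\,d\mu_H(k)$ for $\lambda_H$-almost every $h$. A pair $(Z,\zeta)$, with $Z$ a measurable $H$-space and $\zeta$ a probability measure on $Z$ with $\mu_H*\zeta=\zeta$, is a Poisson boundary of $(H,\mu_H)$ if for every probability measure $\rho_H$ with the same null sets as $\lambda_H$ (equivalently, for one such $\rho_H$) the Poisson transform $\varphi\mapsto\big(h\mapsto\int\varphi(h\cdot z)\,d\zeta(z)\big)$ is an isometry of $L^\infty(Z,\rho_H*\zeta)$ onto $H^\infty_{\lambda_H}(H)$. Let $(X,\nu)$ be a Poisson boundary of $(\Gamma,\mu)$, with $X$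 a standard Borel space. Let $\Gamma$ act on $G\times X$ by $\gamma\star(g,x)=(g\gamma^{-1},\gamma x)$, and let $\mathfrak I$ be the $\sigma$-algebra of measurable sets $A\subseteq G\times X$ such that for $\rho\times\nu$-almost every $(g,x)$ and all $\gamma\in\Gamma$ one has $\gamma\star(g,x)\in A\iff(g,x)\in A$. Regard $\mu$ also as a probability measure on $G$. Then: 1. For every $f\in H^\infty_\lambda(G)$ there is a bounded measurable function $\varphi$ on $G\times X$ such that, for $\rho\times\nu$-almost every $(g,x)$, $\varphi(g\gamma^{-1},\gamma x)=\varphi(g,x)$ for all $\gamma\in\Gamma$, and such that $f(g)=\int\varphi(g,x)\,d\nu(x)$ for $\lambda$-almost every $g$. 2. The Poisson transform $\varphi\mapsto f_\varphi$, $f_\varphi(g)=\int\varphi(g,x)\,d\nu(x)$, is a linear isometry of $L^\infty(G\times X,\mathfrak I,\rho\times\nu)$ onto $H^\infty_\lambda(G)$. 3. The quotient $\widetilde X$ of $G\times X$ by the $\Gamma$-ergodic components is a $G$-Poisson boundary. That is: there are a standard Borel space $\widetilde X$ with a measurable $G$-action and a measurable map $\pi:G\times X\to\widetilde X$ with $\pi(g_0g,x)=g_0\,\pi(g,x)$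 for all $g_0,g\in G$, $x\in X$, such that, modulo $\rho\times\nu$-null sets, $\mathfrak I$ is the $\sigma$-algebra of the preimages under $\pi$ of the measurable subsets of $\widetilde X$; and for every such $\widetilde X$ and $\pi$, if $\widetilde\nu$ denotes the law of $\pi(e,x)$ when $x$ has law $\nu$, then $(\widetilde X,\widetilde\nu)$ is a Poisson boundary of $(G,\mu)$. -/

import Mathlib

open MeasureTheory
open scoped ENNReal

noncomputable section

namespace GammaBoundary

/-- The measure `ρ * ν` on a `G`-space: the law of `g • x` when `(g, x)` has law `ρ × ν`. -/
def actConv {G X : Type*} [MeasurableSpace G] [MeasurableSpace X] [SMul G X]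
    (ρ : Measure G) (ν : Measure X) : Measure X :=
  (ρ.prod ν).map (fun p => p.1 • p.2)

/-- The space `H^∞_lam(G)` of `μ`-harmonic elements of `L^∞(G, lam)`:
`f g = ∫ f (g h) dμ(h)` for `lam`-almost every `g`. -/
def harmonic {G : Type*} [Group G] [MeasurableSpace G] (lam μ : Measure G) :
    Set (Lp ℝ ∞ lam) :=
  {f | ∀ᵐ g ∂lam, f g = ∫ h, f (g * h) ∂μ}

/-- `(X, ν)` is a Poisson boundary of `(G, μ)`, where `lam` is the right Haar measure of `G`
(the counting measure if `G` is countable): `X` is a measurable `G`-space, `ν` is a `μ`-invariant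
probability measure on it, and the Poisson transform `φ ↦ (g ↦ ∫ φ (g • x) dν(x))` is an isometry
of `L^∞(X, ρ * ν)` onto `H^∞_lam(G)`, for the probability measures `ρ` in the class of `lam`
(the null sets of `ρ * ν`, hence this condition, do not depend on the choice of `ρ`). -/
structure IsPoissonBoundary {G X : Type*} [Group G] [MeasurableSpace G] [MeasurableSpace X]
    [MulAction G X] (lam μ : Measure G) (ν : Measure X) : Prop where
  measurable_smul : Measurable (fun p : G × X => p.1 • p.2)
  isProbabilityMeasure : IsProbabilityMeasure ν
  invariant : actConv μ ν = ν
  poisson : ∀ ρ : Measure G, IsProbabilityMeasure ρ → ρ ≪ lam → lam ≪ ρ →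
    ∃ P : Lp ℝ ∞ (actConv ρ ν) →ₗᵢ[ℝ] Lp ℝ ∞ lam,
      (∀ φ : Lp ℝ ∞ (actConv ρ ν), P φ =ᵐ[lam] fun g => ∫ x, φ (g • x) ∂ν) ∧
      Set.range P = harmonic lam μ

section Star

variable {G X : Type*} [Group G] [MeasurableSpace G] (Γ : Subgroup G) [MeasurableSpace X]
  [MulAction Γ X]

/-- The action `γ ⋆ (g, x) = (g γ⁻¹, γ x)` of `Γ` on `G × X`. -/
def star (γ : Γ) (p : G × X) : G × X := (p.1 * (γ : G)⁻¹, γ • p.2)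

/-- The `σ`-algebra `𝔍` of the measurable sets of `G × X` that are almost surely
invariant under the `⋆`-action of `Γ`. -/
def invSigma (ρ : Measure G) (ν : Measure X) : MeasurableSpace (G × X) where
  MeasurableSet' A := MeasurableSet A ∧
    ∀ᵐ p ∂(ρ.prod ν), ∀ γ : Γ, star Γ γ p ∈ A ↔ p ∈ A
  measurableSet_empty := ⟨MeasurableSet.empty, by simp⟩
  measurableSet_compl A hA := ⟨hA.1.compl, by
    filter_upwards [hA.2] with p hp γ
    simp only [Set.mem_compl_iff, hp γ]⟩
  measurableSet_iUnion A hA := ⟨MeasurableSet.iUnion fun i => (hA i).1, by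
    filter_upwards [ae_all_iff.2 fun i => (hA i).2] with p hp γ
    simp only [Set.mem_iUnion, hp _ γ]⟩

/-- `π : G × X → Y` realizes the measurable `G`-space `Y` as the quotient of `(G × X, ρ × ν)` by
the partition into `Γ`-ergodic components: modulo null sets, `𝔍` is the `σ`-algebra of the
preimages under `π` of the measurable subsets of `Y`, and the action of `G` on `Y` is induced
by left multiplication on the first coordinate of `G × X`. -/
structure IsErgodicQuotient (ρ : Measure G) (ν : Measure X) {Y : Type*} [MeasurableSpace Y]
    [MulAction G Y] (π : G × X → Y) : Prop where
  measurable_smul : Measurable (fun p : G × Y => p.1 • p.2)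
  measurable : Measurable π
  equivariant : ∀ (g₀ g : G) (x : X), π (g₀ * g, x) = g₀ • π (g, x)
  preimage_mem : ∀ B : Set Y, MeasurableSet B → MeasurableSet[invSigma Γ ρ ν] (π ⁻¹' B)
  exists_preimage : ∀ A : Set (G × X), MeasurableSet[invSigma Γ ρ ν] A →
    ∃ B : Set Y, MeasurableSet B ∧ A =ᵐ[ρ.prod ν] π ⁻¹' B

end Star

end GammaBoundary

end

set_option linter.unusedSectionVars false

open MeasureTheory
open scoped ENNReal

noncomputable section

/-! Restrict a bounded harmonic `f` to cosets of `Γ`: for almost every `g` the function `γ ↦ f (g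
γ)` is `μ`-harmonic, hence the Poisson transform of a bounded `φ_g` on `X`. Injectivity of that
transform forces `φ_{gγ⁻¹} (γ x) = φ_g x`, so `φ (g, x) = φ_g x` is `⋆`-invariant, and evaluation at
`γ = 1` gives `f g = ∫ φ (g, x) dν`. Conversely, stationarity of `ν` makes fibre integrals of
invariant functions harmonic, and the isometry for `Γ`, applied fibrewise, gives the isometry for
`G` (`exists_poisson_isometry`).

The delicate point is measurability of `φ_g` in `g`. Its pairing with the density of `γν` is `f (g
γ)`, which is measurable in `g`. These densities span a dense subspace of `L¹(ν)`, since a bounded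
function orthogonal to all of them has zero transform. Hence all pairings are measurable, and
differentiation of kernels yields a jointly measurable version (`exists_measurable_poisson`).

For a quotient map `π`, equivariance gives `π (g, x) = g • π (1, x)`. So `π` carries `ρ × ν` to `ρ *
ν̃`, and composition with `π` identifies `L^∞` of the quotient with the `𝔍`-measurable classes,
which transports the boundary property. To construct a quotient, approximate `𝔍` in measure by
countably many sets `A m` and send `(g, x)` to the function `k ↦ ∫ q n (h) 1_{A m}(h k g, x) dρ(h)`,
with `q` dense in `L¹(ρ)`. Averaging makes this continuous in `k`, so it lies in a Polish `G`-space;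
the map is equivariant everywhere, and the averages still determine each `A m` up to a null set. -/

namespace GammaBoundary

/-! ### Duality between `L¹` and bounded functions -/

section Duality

variable {X : Type*} [MeasurableSpace X] {ν : Measure X} [IsFiniteMeasure ν]

/-- The inclusion of `L²` in `L¹` for a finite measure. -/
lemma exists_l2_to_l1 (ν : Measure X) [IsFiniteMeasure ν] :
    ∃ T : Lp ℝ 2 ν →L[ℝ] Lp ℝ 1 ν, ∀ u : Lp ℝ 2 ν, T u =ᵐ[ν] u := by
  have hm : ∀ u : Lp ℝ 2 ν, MemLp u 1 ν := fun u => (Lp.memLp u).mono_exponent (by norm_num)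
  let T₀ : Lp ℝ 2 ν →ₗ[ℝ] Lp ℝ 1 ν :=
    { toFun := fun u => (hm u).toLp u
      map_add' := fun u v => by
        ext1
        filter_upwards [(hm (u + v)).coeFn_toLp, (hm u).coeFn_toLp, (hm v).coeFn_toLp,
          Lp.coeFn_add u v, Lp.coeFn_add ((hm u).toLp u) ((hm v).toLp v)] with x h1 h2 h3 h4 h5
        rw [h1, h4, h5, Pi.add_apply, Pi.add_apply, h2, h3]
      map_smul' := fun c u => by
        ext1
        filter_upwards [(hm (c • u)).coeFn_toLp, (hm u).coeFn_toLp,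
          Lp.coeFn_smul c u, Lp.coeFn_smul c ((hm u).toLp u)] with x h1 h2 h4 h5
        simp [h1, h2, h4, h5] }
  refine ⟨T₀.mkContinuous ((ν Set.univ) ^ (1 / (1 : ℝ≥0∞).toReal - 1 / (2 : ℝ≥0∞).toReal)).toReal
    fun u => ?_, fun u => (hm u).coeFn_toLp⟩
  have h := eLpNorm_le_eLpNorm_mul_rpow_measure_univ (μ := ν) (p := 1) (q := 2) (by norm_num)
    (Lp.aestronglyMeasurable u)
  change ‖(hm u).toLp u‖ ≤ _
  rw [Lp.norm_toLp, Lp.norm_def, mul_comm, ← ENNReal.toReal_mul]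
  refine ENNReal.toReal_mono (ENNReal.mul_ne_top (Lp.eLpNorm_ne_top u) ?_) h
  exact ENNReal.rpow_ne_top_of_nonneg (by norm_num) (measure_ne_top _ _)

/-- The dual of `L¹` of a finite measure consists of bounded measurable functions. -/
lemma exists_bounded_eq_integral_mul (ℓ : Lp ℝ 1 ν →L[ℝ] ℝ) :
    ∃ ψ : X → ℝ, Measurable ψ ∧ (∃ C, ∀ x, |ψ x| ≤ C) ∧ ∀ q : Lp ℝ 1 ν, ℓ q = ∫ x, q x * ψ x ∂ν := by
  obtain ⟨T, hT⟩ := exists_l2_to_l1 ν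
  -- The Riesz representation in `L²` supplies the density; its boundedness comes from testing on
  -- indicators.
  obtain ⟨w, hw⟩ := (InnerProductSpace.toDual ℝ (Lp ℝ 2 ν)).surjective (ℓ.comp T)
  have hwi : Integrable w ν := (Lp.memLp w).integrable (by norm_num)
  have hind : ∀ (B : Set X) (hB : MeasurableSet B),
      ℓ (indicatorConstLp 1 hB (measure_ne_top ν B) (1 : ℝ)) = ∫ x in B, w x ∂ν := by
    intro B hB
    have h1 : T (indicatorConstLp 2 hB (measure_ne_top ν B) (1 : ℝ))
        = indicatorConstLp 1 hB (measure_ne_top ν B) (1 : ℝ) := by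
      ext1
      exact (hT _).trans (indicatorConstLp_coeFn.trans indicatorConstLp_coeFn.symm)
    have h2 : ℓ (T (indicatorConstLp 2 hB (measure_ne_top ν B) (1 : ℝ))) = _ :=
      (DFunLike.congr_fun hw _).symm
    rw [← h1, h2, InnerProductSpace.toDual_apply_apply, real_inner_comm,
      L2.inner_indicatorConstLp_one]
  have hb : ∀ (B : Set X), MeasurableSet B → |∫ x in B, w x ∂ν| ≤ ‖ℓ‖ * ν.real B := by
    intro B hB
    rw [← hind B hB]
    refine (ℓ.le_opNorm _).trans ?_
    gcongr
    rw [norm_indicatorConstLp (by norm_num) (by norm_num)]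
    simp
  have hle : ∀ᵐ x ∂ν, |w x| ≤ ‖ℓ‖ := by
    have h1 : w ≤ᵐ[ν] fun _ => ‖ℓ‖ := by
      refine ae_le_of_forall_setIntegral_le hwi (integrable_const _) fun B hB _ => ?_
      rw [setIntegral_const, smul_eq_mul, mul_comm]
      exact (le_abs_self _).trans (hb B hB)
    have h2 : (fun _ => -‖ℓ‖) ≤ᵐ[ν] w := by
      refine ae_le_of_forall_setIntegral_le (integrable_const _) hwi fun B hB _ => ?_
      rw [setIntegral_const, smul_eq_mul]
      have := neg_le_of_abs_le (hb B hB)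
      linarith
    filter_upwards [h1, h2] with x h1 h2 using abs_le.2 ⟨h2, h1⟩
  have hwm : Measurable w := (Lp.stronglyMeasurable w).measurable
  let ψ : X → ℝ := fun x => max (-‖ℓ‖) (min ‖ℓ‖ (w x))
  have hψm : Measurable ψ := measurable_const.max (measurable_const.min hwm)
  have hψb : ∀ x, |ψ x| ≤ ‖ℓ‖ := fun x =>
    abs_le.2 ⟨le_max_left _ _, max_le (by linarith [norm_nonneg ℓ]) (min_le_left _ _)⟩
  have hψw : ψ =ᵐ[ν] w := by
    filter_upwards [hle] with x hx
    simp only [ψ, min_eq_right (abs_le.1 hx).2, max_eq_right (abs_le.1 hx).1]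
  have hψL : MemLp ψ ∞ ν := memLp_top_of_bound hψm.aestronglyMeasurable _ (ae_of_all _ hψb)
  refine ⟨ψ, hψm, ⟨_, hψb⟩, fun q => ?_⟩
  let Λ : Lp ℝ 1 ν →L[ℝ] ℝ :=
    (ContinuousLinearMap.mul ℝ ℝ).lpPairing ν ∞ 1 (hψL.toLp ψ)
  have hΛ : ∀ q : Lp ℝ 1 ν, Λ q = ∫ x, q x * ψ x ∂ν := by
    intro q
    rw [ContinuousLinearMap.lpPairing_eq_integral]
    refine integral_congr_ae ?_
    filter_upwards [hψL.coeFn_toLp] with x hx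
    simp [hx, mul_comm]
  rw [← hΛ]
  refine Lp.induction (p := 1) (by norm_num) (motive := fun q => ℓ q = Λ q) ?_ ?_ ?_ q
  · intro c B hB hνB
    have h1 : ((Lp.simpleFunc.indicatorConst 1 hB hνB.ne c : Lp.simpleFunc ℝ 1 ν) : Lp ℝ 1 ν)
        = c • indicatorConstLp 1 hB (measure_ne_top ν B) (1 : ℝ) := by
      rw [Lp.simpleFunc.coe_indicatorConst]
      ext1
      filter_upwards [indicatorConstLp_coeFn (p := 1) (hs := hB) (hμs := hνB.ne) (c := c),
        Lp.coeFn_smul c (indicatorConstLp 1 hB (measure_ne_top ν B) (1 : ℝ)),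
        indicatorConstLp_coeFn (p := 1) (hs := hB) (hμs := measure_ne_top ν B) (c := (1 : ℝ))]
        with x h1 h2 h3
      rw [h1, h2, Pi.smul_apply, h3]
      by_cases hx : x ∈ B <;> simp [hx]
    rw [h1, map_smul, map_smul, hind, hΛ]
    congr 1
    rw [← integral_indicator hB]
    refine integral_congr_ae ?_
    filter_upwards [indicatorConstLp_coeFn (p := 1) (hs := hB) (hμs := measure_ne_top ν B)
      (c := (1 : ℝ)), hψw] with x h1 h2
    rw [h1]
    by_cases hx : x ∈ B <;> simp [hx, h2]
  · intro f g hf hg _ h1 h2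
    rw [map_add, map_add, h1, h2]
  · exact isClosed_eq ℓ.continuous Λ.continuous

/-- A closed subspace of `L¹` whose annihilator among the bounded functions is trivial is
everything. -/
lemma eq_top_of_forall_bounded (V : Submodule ℝ (Lp ℝ 1 ν)) (hV : IsClosed (V : Set (Lp ℝ 1 ν)))
    (h : ∀ ψ : X → ℝ, Measurable ψ → (∃ C, ∀ x, |ψ x| ≤ C) →
      (∀ q ∈ V, ∫ x, q x * ψ x ∂ν = 0) → ψ =ᵐ[ν] 0) : V = ⊤ := by
  by_contra hne
  obtain ⟨x, hx⟩ : ∃ x, x ∉ V := by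
    by_contra! hc
    exact hne (Submodule.eq_top_iff'.2 hc)
  obtain ⟨ℓ, u, h1, h2⟩ := geometric_hahn_banach_closed_point V.convex hV hx
  have hu : 0 < u := by simpa using h1 0 V.zero_mem
  have hz : ∀ q ∈ V, ℓ q = 0 := by
    intro q hq
    by_contra hne
    -- The multiple is chosen so that `ℓ` takes the value `u + 1` on `V`, against the separation
    -- bound `u`.
    have := h1 (((u + 1) / ℓ q) • q) (V.smul_mem _ hq)
    rw [map_smul, smul_eq_mul, div_mul_cancel₀ _ hne] at this
    linarith
  obtain ⟨ψ, hψ, hψb, hψi⟩ := exists_bounded_eq_integral_mul ℓ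
  have h0 := h ψ hψ hψb fun q hq => by rw [← hψi, hz q hq]
  have : ℓ x = 0 := by
    rw [hψi]
    refine integral_eq_zero_of_ae ?_
    filter_upwards [h0] with y hy
    simp [hy]
  linarith

end Duality

/-! ### Essential bounds, truncation and null sets of convolutions -/

section LpTop

variable {X : Type*} [MeasurableSpace X] {m : Measure X}

lemma norm_lpTop_le {f : Lp ℝ ∞ m} {C : ℝ} (hC : 0 ≤ C) (h : ∀ᵐ x ∂m, |f x| ≤ C) : ‖f‖ ≤ C := by
  rw [Lp.norm_def, eLpNorm_exponent_top]
  exact ENNReal.toReal_le_of_le_ofReal hC (eLpNormEssSup_le_of_ae_bound h)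

lemma ae_abs_le_norm_lpTop (f : Lp ℝ ∞ m) : ∀ᵐ x ∂m, |f x| ≤ ‖f‖ := by
  filter_upwards [ae_le_eLpNormEssSup (f := f) (μ := m)] with x hx
  rw [Lp.norm_def, eLpNorm_exponent_top]
  have hne : eLpNormEssSup f m ≠ ∞ := by
    rw [← eLpNorm_exponent_top]; exact Lp.eLpNorm_ne_top f
  rw [← Real.norm_eq_abs, ← toReal_enorm]
  exact ENNReal.toReal_mono hne hx

end LpTop

/-- Truncation of a real number to `[-C, C]`. -/
def clip (C t : ℝ) : ℝ := max (-C) (min C t)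

lemma measurable_clip (C : ℝ) : Measurable (clip C) :=
  measurable_const.max (measurable_const.min measurable_id)

lemma abs_clip_le {C : ℝ} (hC : 0 ≤ C) (t : ℝ) : |clip C t| ≤ C :=
  abs_le.2 ⟨le_max_left _ _, max_le (by linarith) (min_le_left _ _)⟩

lemma clip_of_abs_le {C t : ℝ} (h : |t| ≤ C) : clip C t = t := by
  rw [clip, min_eq_right (abs_le.1 h).2, max_eq_right (abs_le.1 h).1]

lemma actConv_apply {G X : Type*} [MeasurableSpace G] [MeasurableSpace X] [SMul G X]
    (hm : Measurable fun p : G × X => p.1 • p.2) (ρ : Measure G) (ν : Measure X) [SFinite ν]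
    {B : Set X} (hB : MeasurableSet B) :
    actConv ρ ν B = ∫⁻ g, ν ((fun x => g • x) ⁻¹' B) ∂ρ := by
  rw [actConv, Measure.map_apply hm hB, Measure.prod_apply (hm hB)]
  rfl

lemma actConv_apply_eq_zero {G X : Type*} [MeasurableSpace G] [MeasurableSpace X] [SMul G X]
    (hm : Measurable fun p : G × X => p.1 • p.2) (ρ : Measure G) (ν : Measure X) [SFinite ν]
    {B : Set X} (hB : MeasurableSet B) :
    actConv ρ ν B = 0 ↔ ∀ᵐ g ∂ρ, ν ((fun x => g • x) ⁻¹' B) = 0 := by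
  rw [actConv_apply hm ρ ν hB, lintegral_eq_zero_iff]
  · rfl
  · exact measurable_measure_prodMk_left (hm hB)

/-! ### The Poisson boundary of the countable group -/

section Discrete

variable {Γ X : Type*} [Group Γ] [Countable Γ] [MeasurableSpace Γ] [MeasurableSingletonClass Γ]
  [MeasurableSpace X] [MulAction Γ X] {μ : Measure Γ} {ν : Measure X}

lemma IsPoissonBoundary.measurable_const_smul {G X : Type*} [Group G] [MeasurableSpace G]
    [MeasurableSpace X] [MulAction G X] {lam μ : Measure G} {ν : Measure X}
    (hX : IsPoissonBoundary lam μ ν) (g : G) : Measurable fun x : X => g • x :=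
  hX.measurable_smul.comp measurable_prodMk_left

/-- Stationarity writes `ν` as a mixture of its translates, so it dominates each translate of
positive weight. -/
lemma IsPoissonBoundary.ae_smul_of_ne_zero
    (hX : IsPoissonBoundary (Measure.count : Measure Γ) μ ν)
    {γ : Γ} (hγ : μ {γ} ≠ 0) : ν.map (fun x => γ • x) ≪ ν := by
  have := hX.isProbabilityMeasure
  refine Measure.AbsolutelyContinuous.mk fun B hB h0 => ?_
  rw [Measure.map_apply (hX.measurable_const_smul γ) hB]
  have h1 := h0
  rw [← hX.invariant, actConv_apply_eq_zero hX.measurable_smul μ ν hB] at h1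
  by_contra hne
  refine hγ (measure_mono_null ?_ (ae_iff.1 h1))
  simpa using hne

/-- The elements with this property form a subsemigroup containing the atoms of `μ`. -/
lemma IsPoissonBoundary.map_smul_absolutelyContinuous
    (hX : IsPoissonBoundary (Measure.count : Measure Γ) μ ν)
    (hμ : Subsemigroup.closure {γ : Γ | μ {γ} ≠ 0} = ⊤) (γ : Γ) :
    ν.map (fun x => γ • x) ≪ ν := by
  let S : Subsemigroup Γ :=
    { carrier := {γ | ν.map (fun x => γ • x) ≪ ν}
      mul_mem' := by
        intro a b ha hb
        have h : ν.map (fun x => (a * b) • x) = (ν.map (fun x => b • x)).map (fun x => a • x) := by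
          rw [Measure.map_map (hX.measurable_const_smul a) (hX.measurable_const_smul b)]
          simp only [mul_smul, Function.comp_def]
        change ν.map (fun x => (a * b) • x) ≪ ν
        rw [h]
        exact (Measure.AbsolutelyContinuous.map hb (hX.measurable_const_smul a)).trans ha }
  have h : Subsemigroup.closure {γ : Γ | μ {γ} ≠ 0} ≤ S :=
    Subsemigroup.closure_le.2 fun γ hγ => hX.ae_smul_of_ne_zero hγ
  rw [hμ] at h
  exact h (Subsemigroup.mem_top γ)

lemma ae_count_iff {p : Γ → Prop} : (∀ᵐ γ ∂(Measure.count : Measure Γ), p γ) ↔ ∀ γ, p γ := by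
  rw [ae_iff, Measure.count_eq_zero_iff, Set.eq_empty_iff_forall_notMem]
  simp

/-- `toFinite` charges every point of `Γ`, so a null set of the convolution is null for each
translate of `ν` separately. -/
lemma IsPoissonBoundary.ae_smul_of_ae_actConv
    (hX : IsPoissonBoundary (Measure.count : Measure Γ) μ ν)
    {p : X → Prop}
    (h : ∀ᵐ x ∂(actConv (Measure.count : Measure Γ).toFinite ν), p x) (γ : Γ) :
    ∀ᵐ x ∂ν, p (γ • x) := by
  have := hX.isProbabilityMeasure
  obtain ⟨B, hB, hBm, hB0⟩ := exists_measurable_superset_of_null (ae_iff.1 h)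
  rw [actConv_apply_eq_zero hX.measurable_smul _ ν hBm] at hB0
  have h1 := ae_count_iff.1 ((absolutelyContinuous_toFinite _).ae_le hB0) γ
  refine measure_mono_null ?_ h1
  intro x hx
  exact hB hx

/-- The Poisson transform of a bounded function determines its supremum norm. -/
lemma IsPoissonBoundary.ae_abs_le
    (hX : IsPoissonBoundary (Measure.count : Measure Γ) μ ν) {φ : X → ℝ} (hφ : Measurable φ)
    {C' : ℝ} (hφC' : ∀ γ : Γ, ∀ᵐ x ∂ν, |φ (γ • x)| ≤ C')
    {C : ℝ} (hC : ∀ γ : Γ, |∫ x, φ (γ • x) ∂ν| ≤ C) : ∀ᵐ x ∂ν, |φ x| ≤ C := by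
  have := hX.isProbabilityMeasure
  set η := actConv (Measure.count : Measure Γ).toFinite ν with hη
  obtain ⟨P, hP, -⟩ := hX.poisson (Measure.count : Measure Γ).toFinite inferInstance
    (toFinite_absolutelyContinuous _) (absolutelyContinuous_toFinite _)
  have hb : ∀ᵐ x ∂η, |φ x| ≤ C' := by
    have hs : MeasurableSet {x | ¬ |φ x| ≤ C'} :=
      (measurableSet_le hφ.abs measurable_const).compl
    rw [ae_iff, actConv_apply_eq_zero hX.measurable_smul _ ν hs]
    exact ae_of_all _ hφC'
  have hL : MemLp φ ∞ η := memLp_top_of_bound hφ.aestronglyMeasurable _ hb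
  have hC0 : 0 ≤ C := (abs_nonneg _).trans (hC 1)
  have h1 : ‖P (hL.toLp φ)‖ ≤ C := by
    refine norm_lpTop_le hC0 ?_
    filter_upwards [hP (hL.toLp φ)] with γ hγ
    rw [hγ]
    convert hC γ using 2
    refine integral_congr_ae ?_
    filter_upwards [hX.ae_smul_of_ae_actConv hL.coeFn_toLp γ] with x hx using hx
  -- Isometry turns the bound on the transform into a bound on `φ`, first for the convolution; `γ =
  -- 1` then returns it to `ν`.
  rw [P.norm_map] at h1
  have h2 : ∀ᵐ x ∂η, |φ x| ≤ C := by
    filter_upwards [hL.coeFn_toLp, ae_abs_le_norm_lpTop (hL.toLp φ)] with x h3 h4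
    rw [← h3]; exact h4.trans h1
  simpa using hX.ae_smul_of_ae_actConv h2 1

/-- Every bounded harmonic function is the Poisson transform of a bounded function. -/
lemma IsPoissonBoundary.exists_poisson
    (hX : IsPoissonBoundary (Measure.count : Measure Γ) μ ν) {F : Γ → ℝ} {C : ℝ}
    (hF : ∀ γ, |F γ| ≤ C) (hh : ∀ γ, F γ = ∫ h, F (γ * h) ∂μ) :
    ∃ φ : X → ℝ, Measurable φ ∧ (∀ x, |φ x| ≤ C) ∧ ∀ γ : Γ, ∫ x, φ (γ • x) ∂ν = F γ := by
  obtain ⟨P, hP, hr⟩ := hX.poisson (Measure.count : Measure Γ).toFinite inferInstance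
    (toFinite_absolutelyContinuous _) (absolutelyContinuous_toFinite _)
  have hC0 : 0 ≤ C := (abs_nonneg _).trans (hF 1)
  have hL : MemLp F ∞ (Measure.count : Measure Γ) :=
    memLp_top_of_bound (measurable_of_countable F).aestronglyMeasurable _ (ae_of_all _ hF)
  have he : ∀ γ, hL.toLp F γ = F γ := ae_count_iff.1 hL.coeFn_toLp
  have hm : hL.toLp F ∈ harmonic (Measure.count : Measure Γ) μ :=
    ae_count_iff.2 fun γ => by simp only [he]; exact hh γ
  rw [← hr] at hm
  obtain ⟨φ, hφ⟩ := hm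
  have hn : ‖φ‖ ≤ C := by
    rw [← P.norm_map, hφ]
    exact norm_lpTop_le hC0 (ae_count_iff.2 fun γ => by rw [he]; exact hF γ)
  refine ⟨fun x => clip C (φ x), (measurable_clip C).comp (Lp.stronglyMeasurable φ).measurable,
    fun x => abs_clip_le hC0 _, fun γ => ?_⟩
  have h1 := ae_count_iff.1 (hP φ) γ
  rw [hφ, he] at h1
  rw [h1]
  refine integral_congr_ae ?_
  filter_upwards [hX.ae_smul_of_ae_actConv (ae_abs_le_norm_lpTop φ) γ] with x hx
  exact clip_of_abs_le (hx.trans hn)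

end Discrete

/-- Integration against a family of bounded functions gives continuous functionals on `L¹`. -/
lemma exists_pairing {Ω X : Type*} [MeasurableSpace X] {ν : Measure X} {φ : Ω → X → ℝ}
    (hφ : ∀ ω, Measurable (φ ω)) {C : ℝ} (hφC : ∀ ω x, |φ ω x| ≤ C) :
    ∃ Λ : Ω → Lp ℝ 1 ν →L[ℝ] ℝ, ∀ ω (q : Lp ℝ 1 ν), Λ ω q = ∫ x, q x * φ ω x ∂ν := by
  have hL : ∀ ω, MemLp (φ ω) ∞ ν := fun ω =>
    memLp_top_of_bound (hφ ω).aestronglyMeasurable _ (ae_of_all _ (hφC ω))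
  refine ⟨fun ω => (ContinuousLinearMap.mul ℝ ℝ).lpPairing ν ∞ 1 ((hL ω).toLp (φ ω)),
    fun ω q => ?_⟩
  rw [ContinuousLinearMap.lpPairing_eq_integral]
  refine integral_congr_ae ?_
  filter_upwards [(hL ω).coeFn_toLp] with x hx
  simp [hx, mul_comm]

section Discrete

variable {Γ X : Type*} [Group Γ] [Countable Γ] [MeasurableSpace Γ] [MeasurableSingletonClass Γ]
  [MeasurableSpace X] [MulAction Γ X] {μ : Measure Γ} {ν : Measure X}

lemma IsPoissonBoundary.ae_smul
    (hX : IsPoissonBoundary (Measure.count : Measure Γ) μ ν)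
    (hμ : Subsemigroup.closure {γ : Γ | μ {γ} ≠ 0} = ⊤) {p : X → Prop} (h : ∀ᵐ x ∂ν, p x)
    (γ : Γ) : ∀ᵐ x ∂ν, p (γ • x) :=
  ae_of_ae_map (hX.measurable_const_smul γ).aemeasurable
    ((hX.map_smul_absolutelyContinuous hμ γ).ae_le h)

/-- Bounded functions on a Poisson boundary with the same Poisson transform agree. -/
lemma IsPoissonBoundary.ae_eq_of_poisson_eq
    (hX : IsPoissonBoundary (Measure.count : Measure Γ) μ ν)
    {φ ψ : X → ℝ} (hφ : Measurable φ) (hψ : Measurable ψ) {C : ℝ} (hφC : ∀ x, |φ x| ≤ C)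
    (hψC : ∀ x, |ψ x| ≤ C) (h : ∀ γ : Γ, ∫ x, φ (γ • x) ∂ν = ∫ x, ψ (γ • x) ∂ν) : φ =ᵐ[ν] ψ := by
  have := hX.isProbabilityMeasure
  have hi : ∀ {θ : X → ℝ} (_ : Measurable θ) (_ : ∀ x, |θ x| ≤ C) (γ : Γ),
      Integrable (fun x => θ (γ • x)) ν := fun hθ hθC γ =>
    .of_bound (hθ.comp (hX.measurable_const_smul γ)).aestronglyMeasurable C
      (ae_of_all _ fun x => hθC _)
  have h1 := hX.ae_abs_le (φ := fun x => φ x - ψ x) (hφ.sub hψ) (C' := C + C) (C := 0)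
    (fun γ => ae_of_all _ fun x => (abs_sub _ _).trans (add_le_add (hφC _) (hψC _)))
    (fun γ => by rw [integral_sub (hi hφ hφC γ) (hi hψ hψC γ), h γ, sub_self, abs_zero])
  filter_upwards [h1] with x hx
  exact sub_eq_zero.1 (abs_nonpos_iff.1 hx)

/-- The weak-* measurability of the inverse Poisson transform. -/
lemma IsPoissonBoundary.measurable_integral_mul
    (hX : IsPoissonBoundary (Measure.count : Measure Γ) μ ν)
    (hμ : Subsemigroup.closure {γ : Γ | μ {γ} ≠ 0} = ⊤)
    {Ω : Type*} [MeasurableSpace Ω] {φ : Ω → X → ℝ} (hφ : ∀ ω, Measurable (φ ω)) {C : ℝ}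
    (hφC : ∀ ω x, |φ ω x| ≤ C)
    (hF : ∀ γ : Γ, Measurable fun ω => ∫ x, φ ω (γ • x) ∂ν)
    (q : Lp ℝ 1 ν) : Measurable fun ω => ∫ x, q x * φ ω x ∂ν := by
  have := hX.isProbabilityMeasure
  obtain ⟨Λ, hΛ⟩ := exists_pairing (ν := ν) hφ hφC
  -- The test functions with measurable pairing form a closed subspace, so it suffices that its
  -- annihilator vanish.
  let V : Submodule ℝ (Lp ℝ 1 ν) :=
    { carrier := {q | Measurable fun ω => Λ ω q}
      add_mem' := fun {a b} ha hb => by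
        simp only [Set.mem_ofPred_eq, map_add] at ha hb ⊢
        exact ha.add hb
      zero_mem' := by simp
      smul_mem' := fun c a ha => by
        simp only [Set.mem_ofPred_eq, map_smul, smul_eq_mul] at ha ⊢
        exact ha.const_mul c }
  have hVc : IsClosed (V : Set (Lp ℝ 1 ν)) := by
    refine IsSeqClosed.isClosed fun u q hu huq => ?_
    refine measurable_of_tendsto_metrizable (f := fun n ω => Λ ω (u n)) hu ?_
    exact tendsto_pi_nhds.2 fun ω => ((Λ ω).continuous.tendsto q).comp huq
  have hV : V = ⊤ := by
    refine eq_top_of_forall_bounded V hVc fun ψ hψ ⟨D, hD⟩ h => ?_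
    -- Pairing with the density of `γν` evaluates the Poisson transform at `γ`; hence these
    -- densities lie in `V`.
    have key : ∀ (γ : Γ) (θ : X → ℝ), Measurable θ →
        ∫ x, ((ν.map fun x => γ • x).rnDeriv ν x).toReal * θ x ∂ν = ∫ x, θ (γ • x) ∂ν := by
      intro γ θ hθ
      have hac := hX.map_smul_absolutelyContinuous hμ γ
      have : IsProbabilityMeasure (ν.map fun x => γ • x) :=
        Measure.isProbabilityMeasure_map (hX.measurable_const_smul γ).aemeasurable
      have h1 := integral_rnDeriv_smul (f := θ) hac
      simp only [smul_eq_mul] at h1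
      rw [h1, integral_map (hX.measurable_const_smul γ).aemeasurable hθ.aestronglyMeasurable]
    have h0 : ∀ γ : Γ, ∫ x, ψ (γ • x) ∂ν = 0 := by
      intro γ
      have : IsProbabilityMeasure (ν.map fun x => γ • x) :=
        Measure.isProbabilityMeasure_map (hX.measurable_const_smul γ).aemeasurable
      have hki : Integrable (fun x => ((ν.map fun x => γ • x).rnDeriv ν x).toReal) ν :=
        Measure.integrable_toReal_rnDeriv
      have hk : ∀ θ : X → ℝ, ∫ x, (hki.toL1 _) x * θ x ∂ν
          = ∫ x, ((ν.map fun x => γ • x).rnDeriv ν x).toReal * θ x ∂ν := by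
        intro θ
        refine integral_congr_ae ?_
        filter_upwards [hki.coeFn_toL1] with x hx
        rw [hx]
      rw [← key γ ψ hψ, ← hk]
      refine h _ ?_
      change Measurable fun ω => Λ ω _
      simp only [hΛ, hk, fun ω => key γ (φ ω) (hφ ω)]
      exact hF γ
    refine hX.ae_eq_of_poisson_eq hψ measurable_const (C := D) hD
      (fun x => by simpa using (abs_nonneg _).trans (hD x)) fun γ => ?_
    simpa using h0 γ
  simp only [← hΛ]
  exact (hV ▸ Submodule.mem_top : q ∈ V)

/-- A weakly measurable family of bounded functions has a jointly measurable version. -/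
lemma exists_jointly_measurable_version {Ω X : Type*} [MeasurableSpace Ω] [MeasurableSpace X]
    [MeasurableSpace.CountablyGenerated X] {ν : Measure X} [IsFiniteMeasure ν] {φ : Ω → X → ℝ}
    (hφm : ∀ ω, Measurable (φ ω)) {C : ℝ} (hC : 0 ≤ C) (hφC : ∀ ω x, |φ ω x| ≤ C)
    (hmeas : ∀ q : Lp ℝ 1 ν, Measurable fun ω => ∫ x, q x * φ ω x ∂ν) :
    ∃ Φ : Ω × X → ℝ, Measurable Φ ∧ (∀ p, |Φ p| ≤ C) ∧
      ∀ ω, (fun x => Φ (ω, x)) =ᵐ[ν] φ ω := by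
  have hset : ∀ B : Set X, MeasurableSet B → Measurable fun ω => ∫ x in B, φ ω x ∂ν := by
    intro B hB
    convert hmeas (indicatorConstLp 1 hB (measure_ne_top ν B) (1 : ℝ)) using 2 with ω
    rw [← integral_indicator hB]
    refine integral_congr_ae ?_
    filter_upwards [indicatorConstLp_coeFn (p := 1) (hs := hB) (hμs := measure_ne_top ν B)
      (c := (1 : ℝ))] with x hx
    rw [hx]
    by_cases h : x ∈ B <;> simp [h]
  have hφi : ∀ ω, Integrable (φ ω) ν := fun ω =>
    .of_bound (hφm ω).aestronglyMeasurable C (ae_of_all _ fun x => hφC ω x)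
  have hnn : ∀ ω x, 0 ≤ φ ω x + C := fun ω x => by linarith [neg_le_of_abs_le (hφC ω x)]
  have hval : ∀ ω (B : Set X), MeasurableSet B →
      ν.withDensity (fun x => ENNReal.ofReal (φ ω x + C)) B
        = ENNReal.ofReal (∫ x in B, φ ω x ∂ν + C * ν.real B) := by
    intro ω B hB
    have hi : IntegrableOn (fun x => φ ω x + C) B ν :=
      ((hφi ω).add (integrable_const C)).integrableOn
    rw [withDensity_apply _ hB, ← ofReal_integral_eq_lintegral_ofReal hi (ae_of_all _ (hnn ω)),
      integral_add (hφi ω).integrableOn (integrable_const C), setIntegral_const, smul_eq_mul,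
      mul_comm]
  -- The shift by `C` makes the densities nonnegative. The derivative of this kernel with respect to
  -- `ν` is jointly measurable, and subtracting `C` recovers the family.
  let κ : ProbabilityTheory.Kernel Ω X :=
    { toFun := fun ω => ν.withDensity fun x => ENNReal.ofReal (φ ω x + C)
      measurable' := Measure.measurable_of_measurable_coe _ fun B hB => by
        simp only [hval _ B hB]
        exact ((hset B hB).add_const _).ennreal_ofReal }
  have hκ : ∀ ω, κ ω = ν.withDensity fun x => ENNReal.ofReal (φ ω x + C) := fun ω => rfl
  have hfin : ProbabilityTheory.IsFiniteKernel κ := by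
    refine ⟨⟨ENNReal.ofReal (ν.real Set.univ * C + C * ν.real Set.univ), ENNReal.ofReal_lt_top, fun ω => ?_⟩⟩
    rw [hκ, hval ω _ MeasurableSet.univ]
    have : ∫ x, φ ω x ∂ν ≤ ∫ x, C ∂ν :=
      integral_mono (hφi ω) (integrable_const C) fun x => (abs_le.1 (hφC ω x)).2
    simp only [integral_const, smul_eq_mul] at this
    rw [setIntegral_univ]
    exact ENNReal.ofReal_le_ofReal (by linarith)
  let D := κ.rnDeriv (ProbabilityTheory.Kernel.const Ω ν)
  have hD : ∀ ω, D ω =ᵐ[ν] fun x => ENNReal.ofReal (φ ω x + C) := by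
    intro ω
    have h1 := ProbabilityTheory.Kernel.rnDeriv_eq_rnDeriv_measure (κ := κ)
      (η := ProbabilityTheory.Kernel.const Ω ν) (a := ω)
    rw [ProbabilityTheory.Kernel.const_apply, hκ] at h1
    exact h1.trans (Measure.rnDeriv_withDensity _ ((hφm ω).add_const C).ennreal_ofReal)
  refine ⟨fun p => clip C ((D p.1 p.2).toReal - C), (measurable_clip C).comp
    ((ProbabilityTheory.Kernel.measurable_rnDeriv κ _).ennreal_toReal.sub_const C),
    fun p => abs_clip_le hC _, fun ω => ?_⟩
  filter_upwards [hD ω] with x hx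
  rw [hx, ENNReal.toReal_ofReal (hnn _ _), add_sub_cancel_right, clip_of_abs_le (hφC _ _)]

/-- The inverse Poisson transform of a measurable family of bounded harmonic functions has a
jointly measurable version. -/
lemma IsPoissonBoundary.exists_measurable_poisson [StandardBorelSpace X]
    (hX : IsPoissonBoundary (Measure.count : Measure Γ) μ ν)
    (hμ : Subsemigroup.closure {γ : Γ | μ {γ} ≠ 0} = ⊤)
    {Ω : Type*} [MeasurableSpace Ω] {F : Ω → Γ → ℝ} (hFm : ∀ γ, Measurable fun ω => F ω γ)
    {C : ℝ} (hC : 0 ≤ C) (hF : ∀ ω γ, |F ω γ| ≤ C)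
    (hh : ∀ ω γ, F ω γ = ∫ h, F ω (γ * h) ∂μ) :
    ∃ Φ : Ω × X → ℝ, Measurable Φ ∧ (∀ p, |Φ p| ≤ C) ∧
      ∀ ω (γ : Γ), ∫ x, Φ (ω, γ • x) ∂ν = F ω γ := by
  have := hX.isProbabilityMeasure
  choose φ hφm hφC hφF using fun ω => hX.exists_poisson (hF ω) (hh ω)
  have hmeas := hX.measurable_integral_mul hμ hφm hφC (by simpa only [hφF] using hFm)
  obtain ⟨Φ, hΦ, hΦC, h⟩ := exists_jointly_measurable_version hφm hC hφC hmeas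
  refine ⟨Φ, hΦ, hΦC, fun ω γ => ?_⟩
  rw [← hφF ω γ]
  exact integral_congr_ae (hX.ae_smul hμ (h ω) γ)

end Discrete

/-! ### Invariant functions and fibre integrals -/

section Invariant

variable {G X : Type*} [Group G] [MeasurableSpace G] {Γ : Subgroup G} [MeasurableSpace X]
  [MulAction Γ X] {ρ : Measure G} {ν : Measure X}

lemma invSigma_le : invSigma Γ ρ ν ≤ (inferInstance : MeasurableSpace (G × X)) := fun _ hA => hA.1

/-- Rational sublevel sets determine a real function, so countably many exceptional sets suffice. -/
lemma ae_invariant_of_measurable_invSigma {φ : G × X → ℝ} (hφ : Measurable[invSigma Γ ρ ν] φ) :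
    ∀ᵐ p ∂(ρ.prod ν), ∀ γ : Γ, φ (star Γ γ p) = φ p := by
  have h : ∀ᵐ p ∂(ρ.prod ν), ∀ q : ℚ, ∀ γ : Γ,
      star Γ γ p ∈ φ ⁻¹' Set.Iio (q : ℝ) ↔ p ∈ φ ⁻¹' Set.Iio (q : ℝ) :=
    ae_all_iff.2 fun q => (hφ measurableSet_Iio).2
  filter_upwards [h] with p hp γ
  refine eq_of_forall_lt_rat_iff_lt fun q => ?_
  simpa using hp q γ

lemma measurable_invSigma_of_ae_invariant {φ : G × X → ℝ} (hφ : Measurable φ)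
    (h : ∀ᵐ p ∂(ρ.prod ν), ∀ γ : Γ, φ (star Γ γ p) = φ p) : Measurable[invSigma Γ ρ ν] φ := by
  intro B hB
  refine ⟨hφ hB, ?_⟩
  filter_upwards [h] with p hp γ
  rw [Set.mem_preimage, Set.mem_preimage, hp γ]

/-- `𝔍` sees only the null sets of `ρ`; this allows `ρ` to vary as the definition of a Poisson
boundary requires. -/
lemma invSigma_congr {ρ' : Measure G} [SFinite ρ] [SFinite ρ'] [SFinite ν]
    (h : ρ ≪ ρ') (h' : ρ' ≪ ρ) : invSigma Γ ρ ν = invSigma Γ ρ' ν := by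
  have e : ae (ρ.prod ν) = ae (ρ'.prod ν) :=
    le_antisymm (Measure.AbsolutelyContinuous.prod h .rfl).ae_le
      (Measure.AbsolutelyContinuous.prod h' .rfl).ae_le
  ext A
  change (_ ∧ ∀ᶠ p in ae (ρ.prod ν), _) ↔ (_ ∧ ∀ᶠ p in ae (ρ'.prod ν), _)
  rw [e]

/-- A bounded class measurable for `𝔍` has a bounded invariant representative. -/
lemma exists_bounded_invariant_rep
    (φ : lpMeas ℝ ℝ (invSigma Γ ρ ν) ∞ (ρ.prod ν)) :
    ∃ φ' : G × X → ℝ, Measurable φ' ∧ (∀ p, |φ' p| ≤ ‖φ‖) ∧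
      (∀ᵐ p ∂(ρ.prod ν), ∀ γ : Γ, φ' (star Γ γ p) = φ' p) ∧
      (φ : Lp ℝ ∞ (ρ.prod ν)) =ᵐ[ρ.prod ν] φ' := by
  obtain ⟨θ, hθ, hφθ⟩ := lpMeas.aestronglyMeasurable φ
  have hm : Measurable[invSigma Γ ρ ν] fun p => clip ‖φ‖ (θ p) :=
    (measurable_clip _).comp hθ.measurable
  refine ⟨fun p => clip ‖φ‖ (θ p), hm.mono invSigma_le le_rfl,
    fun p => abs_clip_le (norm_nonneg _) _, ae_invariant_of_measurable_invSigma hm, ?_⟩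
  filter_upwards [hφθ, ae_abs_le_norm_lpTop (φ : Lp ℝ ∞ (ρ.prod ν))] with p h1 h2
  rw [← h1]
  exact (clip_of_abs_le h2).symm

end Invariant

section FiberIntegral

variable {G X : Type*} [MeasurableSpace G] [MeasurableSpace X] {lam ρ : Measure G} {ν : Measure X}
  [SFinite ρ] [IsProbabilityMeasure ν]

lemma ae_fiber_eq (h : lam ≪ ρ) {φ ψ : G × X → ℝ} (hφ : φ =ᵐ[ρ.prod ν] ψ) :
    ∀ᵐ g ∂lam, (fun x => φ (g, x)) =ᵐ[ν] fun x => ψ (g, x) :=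
  h.ae_le (Measure.ae_ae_of_ae_prod hφ)

lemma ae_integral_fiber_eq (h : lam ≪ ρ) {φ ψ : G × X → ℝ} (hφ : φ =ᵐ[ρ.prod ν] ψ) :
    (fun g => ∫ x, φ (g, x) ∂ν) =ᵐ[lam] fun g => ∫ x, ψ (g, x) ∂ν := by
  filter_upwards [ae_fiber_eq h hφ] with g hg using integral_congr_ae hg

lemma abs_integral_le_of_ae {φ : X → ℝ} {C : ℝ} (h : ∀ᵐ x ∂ν, |φ x| ≤ C) :
    |∫ x, φ x ∂ν| ≤ C := by
  have := norm_integral_le_of_norm_le_const (μ := ν) (f := φ) (C := C) h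
  simpa using this

/-- Integration over the fibres as a linear map of spaces of bounded functions. -/
lemma exists_fiber_integral (h : lam ≪ ρ) :
    ∃ T : Lp ℝ ∞ (ρ.prod ν) →ₗ[ℝ] Lp ℝ ∞ lam,
      (∀ φ, T φ =ᵐ[lam] fun g => ∫ x, φ (g, x) ∂ν) ∧ ∀ φ, ‖T φ‖ ≤ ‖φ‖ := by
  have hb : ∀ φ : Lp ℝ ∞ (ρ.prod ν), ∀ᵐ g ∂lam, ∀ᵐ x ∂ν, |φ (g, x)| ≤ ‖φ‖ := fun φ =>
    h.ae_le (Measure.ae_ae_of_ae_prod (ae_abs_le_norm_lpTop φ))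
  have hm : ∀ φ : Lp ℝ ∞ (ρ.prod ν), StronglyMeasurable fun g => ∫ x, φ (g, x) ∂ν := fun φ =>
    (Lp.stronglyMeasurable φ).integral_prod_right'
  have hi : ∀ φ : Lp ℝ ∞ (ρ.prod ν), ∀ᵐ g ∂lam, Integrable (fun x => φ (g, x)) ν := fun φ => by
    filter_upwards [hb φ] with g hg
    exact .of_bound ((Lp.stronglyMeasurable φ).measurable.comp
      measurable_prodMk_left).aestronglyMeasurable ‖φ‖ hg
  have hL : ∀ φ : Lp ℝ ∞ (ρ.prod ν), MemLp (fun g => ∫ x, φ (g, x) ∂ν) ∞ lam := fun φ =>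
    memLp_top_of_bound (hm φ).aestronglyMeasurable ‖φ‖ <| by
      filter_upwards [hb φ] with g hg using abs_integral_le_of_ae hg
  refine ⟨{ toFun := fun φ => (hL φ).toLp _, map_add' := ?_, map_smul' := ?_ },
    fun φ => (hL φ).coeFn_toLp, fun φ => ?_⟩
  · intro φ ψ
    ext1
    filter_upwards [(hL (φ + ψ)).coeFn_toLp, (hL φ).coeFn_toLp, (hL ψ).coeFn_toLp,
      Lp.coeFn_add ((hL φ).toLp _) ((hL ψ).toLp _), ae_fiber_eq h (Lp.coeFn_add φ ψ), hi φ, hi ψ]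
      with g h1 h2 h3 h4 h5 h6 h7
    rw [h1, h4, Pi.add_apply, h2, h3, integral_congr_ae h5, ← integral_add h6 h7]
    rfl
  · intro c φ
    ext1
    filter_upwards [(hL (c • φ)).coeFn_toLp, (hL φ).coeFn_toLp,
      Lp.coeFn_smul c ((hL φ).toLp _), ae_fiber_eq h (Lp.coeFn_smul c φ)] with g h1 h2 h3 h4
    rw [h1, RingHom.id_apply, h3, Pi.smul_apply, h2, integral_congr_ae h4, ← integral_smul]
    rfl
  · refine norm_lpTop_le (norm_nonneg _) ?_
    filter_upwards [(hL φ).coeFn_toLp, hb φ] with g h1 h2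
    change |((hL φ).toLp _ : Lp ℝ ∞ lam) g| ≤ _
    rw [h1]
    exact abs_integral_le_of_ae h2

end FiberIntegral

/-! ### The Poisson transform on `G × X` -/

section Transform

variable {G X : Type*}
  [Group G] [TopologicalSpace G] [IsTopologicalGroup G] [T2Space G]
  [SecondCountableTopology G] [MeasurableSpace G] [BorelSpace G]
  {lam : Measure G} [lam.IsMulRightInvariant]
  {ρ : Measure G} [IsProbabilityMeasure ρ]
  {Γ : Subgroup G} [Countable Γ]
  {μ : Measure Γ} [IsProbabilityMeasure μ]
  [MeasurableSpace X] [MulAction Γ X] {ν : Measure X}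

/-- Right invariance of `lam` and countability of `Γ` upgrade almost every point to almost every
whole coset. -/
lemma ae_forall_mul {p : G → Prop} (h : ∀ᵐ g ∂lam, p g) :
    ∀ᵐ g ∂lam, ∀ γ : Γ, p (g * γ) :=
  ae_all_iff.2 fun γ => (measurePreserving_mul_right lam (γ : G)).quasiMeasurePreserving.ae h

lemma integral_map_subtype {f : G → ℝ} (hf : Measurable f) (g : G) :
    ∫ h, f (g * h) ∂(μ.map Γ.subtype) = ∫ γ : Γ, f (g * γ) ∂μ := by
  rw [integral_map]
  · rfl
  · exact measurable_subtype_coe.aemeasurable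
  · exact (hf.comp (measurable_const_mul g)).aestronglyMeasurable

/-- This is invariance under `γ⁻¹` at the point `γ • x`, which is generic because `ν` is
quasi-invariant. -/
lemma ae_fiber_smul (hρ' : lam ≪ ρ)
    (hμ : Subsemigroup.closure {γ : Γ | μ {γ} ≠ 0} = ⊤)
    (hX : IsPoissonBoundary (Measure.count : Measure Γ) μ ν) {φ : G × X → ℝ}
    (hi : ∀ᵐ p ∂(ρ.prod ν), ∀ γ : Γ, φ (star Γ γ p) = φ p) :
    ∀ᵐ g ∂lam, ∀ γ : Γ, ∀ᵐ x ∂ν, φ (g * γ, x) = φ (g, γ • x) := by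
  have := hX.isProbabilityMeasure
  filter_upwards [hρ'.ae_le (Measure.ae_ae_of_ae_prod hi)] with g hg γ
  filter_upwards [hX.ae_smul hμ hg γ] with x hx
  simpa [star] using hx γ⁻¹

/-- The fibre integral of a bounded invariant function satisfies the mean value property. -/
lemma ae_harmonic_of_invariant (hρ' : lam ≪ ρ)
    (hμ : Subsemigroup.closure {γ : Γ | μ {γ} ≠ 0} = ⊤)
    (hX : IsPoissonBoundary (Measure.count : Measure Γ) μ ν) {φ : G × X → ℝ} (hφ : Measurable φ)
    {C : ℝ} (hφC : ∀ p, |φ p| ≤ C)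
    (hi : ∀ᵐ p ∂(ρ.prod ν), ∀ γ : Γ, φ (star Γ γ p) = φ p) :
    ∀ᵐ g ∂lam, ∫ x, φ (g, x) ∂ν = ∫ γ : Γ, ∫ x, φ (g * γ, x) ∂ν ∂μ := by
  have := hX.isProbabilityMeasure
  filter_upwards [ae_fiber_smul hρ' hμ hX hi] with g hg
  have hφg : Measurable fun x => φ (g, x) := hφ.comp measurable_prodMk_left
  simp only [fun γ => integral_congr_ae (hg γ)]
  -- Stationarity replaces `ν` by the mixture of its translates, producing the average over `μ`.
  conv_lhs => rw [← hX.invariant]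
  rw [actConv, integral_map hX.measurable_smul.aemeasurable hφg.aestronglyMeasurable,
    integral_prod]
  exact .of_bound (hφg.comp hX.measurable_smul).aestronglyMeasurable C
    (ae_of_all _ fun p => hφC _)

/-- On the fibre over `g`, the transform at `γ` is the fibre integral at `g γ`. It is bounded by `C`
for all `γ` at once, so the isometry for `Γ` bounds the fibre. -/
lemma ae_abs_le_of_fiber_integral (hρ : ρ ≪ lam) (hρ' : lam ≪ ρ)
    (hμ : Subsemigroup.closure {γ : Γ | μ {γ} ≠ 0} = ⊤)
    (hX : IsPoissonBoundary (Measure.count : Measure Γ) μ ν) {φ : G × X → ℝ} (hφ : Measurable φ)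
    {C' : ℝ} (hφC : ∀ p, |φ p| ≤ C')
    (hi : ∀ᵐ p ∂(ρ.prod ν), ∀ γ : Γ, φ (star Γ γ p) = φ p) {C : ℝ}
    (h : ∀ᵐ g ∂lam, |∫ x, φ (g, x) ∂ν| ≤ C) : ∀ᵐ p ∂(ρ.prod ν), |φ p| ≤ C := by
  have := hX.isProbabilityMeasure
  rw [Measure.ae_prod_iff_ae_ae (measurableSet_le hφ.abs measurable_const)]
  refine hρ.ae_le ?_
  filter_upwards [ae_fiber_smul hρ' hμ hX hi, ae_forall_mul (Γ := Γ) h] with g hg hg'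
  refine hX.ae_abs_le (φ := fun x => φ (g, x)) (hφ.comp measurable_prodMk_left) (C' := C')
    (fun γ => ae_of_all _ fun x => hφC _) fun γ => ?_
  rw [← integral_congr_ae (hg γ)]
  exact hg' γ

/-- Every harmonic function on `G` is the fibre integral of a bounded invariant function. -/
lemma exists_invariant_of_harmonic [StandardBorelSpace X]
    (hμ : Subsemigroup.closure {γ : Γ | μ {γ} ≠ 0} = ⊤)
    (hX : IsPoissonBoundary (Measure.count : Measure Γ) μ ν) {f : Lp ℝ ∞ lam}
    (hf : f ∈ harmonic lam (μ.map Γ.subtype)) :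
    ∃ φ : G × X → ℝ, Measurable φ ∧ (∀ p, |φ p| ≤ ‖f‖) ∧
      (∀ᵐ p ∂(ρ.prod ν), ∀ γ : Γ, φ (star Γ γ p) = φ p) ∧
      f =ᵐ[lam] fun g => ∫ x, φ (g, x) ∂ν := by
  have := hX.isProbabilityMeasure
  have hfm : Measurable f := (Lp.stronglyMeasurable f).measurable
  let S : Set G := {g | |f g| ≤ ‖f‖ ∧ f g = ∫ γ : Γ, f (g * γ) ∂μ}
  have hSm : MeasurableSet S := by
    refine (measurableSet_le hfm.abs measurable_const).inter (measurableSet_eq_fun hfm ?_)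
    have h1 : Measurable fun p : G × Γ => f (p.1 * p.2) :=
      hfm.comp (measurable_fst.mul (measurable_subtype_coe.comp measurable_snd))
    exact h1.stronglyMeasurable.integral_prod_right'.measurable
  have hSae : ∀ᵐ g ∂lam, g ∈ S := by
    filter_upwards [ae_abs_le_norm_lpTop f, hf] with g h1 h2
    exact ⟨h1, by rw [← integral_map_subtype hfm]; exact h2⟩
  -- `S'` is a union of cosets `g Γ`, so cutting `f` off outside it gives the bound and the mean
  -- value property at every point.
  let S' : Set G := {g | ∀ γ : Γ, g * γ ∈ S}
  have hS'm : MeasurableSet S' := by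
    have : S' = ⋂ γ : Γ, (fun g => g * (γ : G)) ⁻¹' S := by
      ext g; simp [S']
    rw [this]
    exact MeasurableSet.iInter fun γ => measurable_mul_const _ hSm
  have hS'ae : ∀ᵐ g ∂lam, g ∈ S' := ae_forall_mul hSae
  have hS'γ : ∀ (g : G) (γ : Γ), g * γ ∈ S' ↔ g ∈ S' := by
    intro g γ
    refine ⟨fun h δ => ?_, fun h δ => ?_⟩
    · simpa [mul_assoc] using h (γ⁻¹ * δ)
    · simpa [mul_assoc] using h (γ * δ)
  let f₀ : G → ℝ := S'.indicator f
  have hf₀m : Measurable f₀ := hfm.indicator hS'm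
  have hf₀ : ∀ (g : G), |f₀ g| ≤ ‖f‖ := by
    intro g
    by_cases h : g ∈ S'
    · simpa [f₀, h] using (h 1).1
    · simp [f₀, h]
  have hf₀h : ∀ g : G, f₀ g = ∫ γ : Γ, f₀ (g * γ) ∂μ := by
    intro g
    by_cases h : g ∈ S'
    · simpa [f₀, h, (hS'γ g _).2 h] using (h 1).2
    · simp [f₀, h, hS'γ g]
  obtain ⟨Φ, hΦm, hΦC, hΦ⟩ := hX.exists_measurable_poisson hμ (F := fun g (γ : Γ) => f₀ (g * γ))
    (fun γ => hf₀m.comp (measurable_mul_const _)) (norm_nonneg f) (fun g γ => hf₀ _)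
    (fun g γ => by simpa [mul_assoc] using hf₀h (g * γ))
  refine ⟨Φ, hΦm, hΦC, ?_, ?_⟩
  · refine ae_all_iff.2 fun γ => ?_
    have hsm : Measurable (star (X := X) Γ γ) :=
      (measurable_fst.mul_const _).prodMk ((hX.measurable_const_smul γ).comp measurable_snd)
    refine (Measure.ae_prod_iff_ae_ae (measurableSet_eq_fun (hΦm.comp hsm) hΦm)).2 ?_
    refine ae_of_all _ fun g => ?_
    -- Both sides have transform `f₀ (g δ)` at `δ`, since `g γ⁻¹ (γ δ) = g δ`.
    refine hX.ae_eq_of_poisson_eq (φ := fun x => Φ (star Γ γ (g, x))) (ψ := fun x => Φ (g, x))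
      (C := ‖f‖) ((hΦm.comp hsm).comp measurable_prodMk_left)
      (hΦm.comp measurable_prodMk_left) (fun x => hΦC _) (fun x => hΦC _) fun δ => ?_
    rw [hΦ g δ]
    simp only [star, smul_smul]
    rw [hΦ]
    simp [mul_assoc]
  · filter_upwards [hS'ae] with g hg
    have := hΦ g 1
    simp only [one_smul, Subgroup.coe_one, mul_one] at this
    rw [this]
    simp [f₀, hg]

/-- The Poisson transform is an isometry of the bounded invariant functions on `G × X` onto the
harmonic functions on `G`. -/
lemma exists_poisson_isometry [StandardBorelSpace X] (hρ : ρ ≪ lam) (hρ' : lam ≪ ρ)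
    (hμ : Subsemigroup.closure {γ : Γ | μ {γ} ≠ 0} = ⊤)
    (hX : IsPoissonBoundary (Measure.count : Measure Γ) μ ν) :
    ∃ P : lpMeas ℝ ℝ (invSigma Γ ρ ν) ∞ (ρ.prod ν) →ₗᵢ[ℝ] Lp ℝ ∞ lam,
      (∀ φ : lpMeas ℝ ℝ (invSigma Γ ρ ν) ∞ (ρ.prod ν),
        P φ =ᵐ[lam] fun g => ∫ x, (φ : Lp ℝ ∞ (ρ.prod ν)) (g, x) ∂ν) ∧
      Set.range P = harmonic lam (μ.map Γ.subtype) := by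
  have := hX.isProbabilityMeasure
  obtain ⟨T, hT, hTn⟩ := exists_fiber_integral (ν := ν) hρ'
  let P : lpMeas ℝ ℝ (invSigma Γ ρ ν) ∞ (ρ.prod ν) →ₗᵢ[ℝ] Lp ℝ ∞ lam :=
    { T.comp (lpMeas ℝ ℝ (invSigma Γ ρ ν) ∞ (ρ.prod ν)).subtype with
      norm_map' := fun φ => by
        change ‖T (φ : Lp ℝ ∞ (ρ.prod ν))‖ = ‖(φ : Lp ℝ ∞ (ρ.prod ν))‖
        refine le_antisymm (hTn _) ?_
        obtain ⟨φ', hm, hb, hi, he⟩ := exists_bounded_invariant_rep φ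
        refine norm_lpTop_le (norm_nonneg _) ?_
        filter_upwards [he, ae_abs_le_of_fiber_integral hρ hρ' hμ hX hm hb hi
          (C := ‖T (φ : Lp ℝ ∞ (ρ.prod ν))‖) (by
            filter_upwards [hT φ, ae_integral_fiber_eq hρ' he,
              ae_abs_le_norm_lpTop (T (φ : Lp ℝ ∞ (ρ.prod ν)))] with g h1 h2 h3
            rwa [← h2, ← h1])] with p h1 h2
        rwa [h1] }
  have hP : ∀ φ : lpMeas ℝ ℝ (invSigma Γ ρ ν) ∞ (ρ.prod ν),
      P φ =ᵐ[lam] fun g => ∫ x, (φ : Lp ℝ ∞ (ρ.prod ν)) (g, x) ∂ν := fun φ => hT φ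
  refine ⟨P, hP, Set.Subset.antisymm ?_ ?_⟩
  · rintro _ ⟨φ, rfl⟩
    obtain ⟨φ', hm, hb, hi, he⟩ := exists_bounded_invariant_rep φ
    have h0 : P φ =ᵐ[lam] fun g => ∫ x, φ' (g, x) ∂ν := (hP φ).trans (ae_integral_fiber_eq hρ' he)
    change ∀ᵐ g ∂lam, _
    filter_upwards [h0, ae_forall_mul (Γ := Γ) h0, ae_harmonic_of_invariant hρ' hμ hX hm hb hi]
      with g h1 h2 h3
    rw [integral_map_subtype (Lp.stronglyMeasurable _).measurable, h1, h3]
    simp only [h2]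
  · intro f hf
    obtain ⟨φ, hm, hb, hi, he⟩ := exists_invariant_of_harmonic (ρ := ρ) hμ hX hf
    have hL : MemLp φ ∞ (ρ.prod ν) := memLp_top_of_bound hm.aestronglyMeasurable _ (ae_of_all _ hb)
    refine ⟨⟨hL.toLp φ, ?_⟩, ?_⟩
    · rw [mem_lpMeas_iff_aestronglyMeasurable]
      exact ⟨φ, (measurable_invSigma_of_ae_invariant hm hi).stronglyMeasurable, hL.coeFn_toLp⟩
    · ext1
      exact ((hP _).trans (ae_integral_fiber_eq hρ' hL.coeFn_toLp)).trans he.symm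

end Transform

/-! ### Functions and measures on an ergodic quotient -/

section Quotient

variable {G X : Type*} [Group G] [MeasurableSpace G] {Γ : Subgroup G} [MeasurableSpace X]
  [MulAction Γ X] {ρ : Measure G} {ν : Measure X}
  {Y : Type*} [MeasurableSpace Y] [MulAction G Y] {π : G × X → Y}

lemma IsErgodicQuotient.measurable_invSigma (hπ : IsErgodicQuotient Γ ρ ν π) :
    Measurable[invSigma Γ ρ ν] π := fun B hB => hπ.preimage_mem B hB

lemma IsErgodicQuotient.ae_invariant [StandardBorelSpace Y] (hπ : IsErgodicQuotient Γ ρ ν π) :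
    ∀ᵐ p ∂(ρ.prod ν), ∀ γ : Γ, π (star Γ γ p) = π p := by
  obtain ⟨e, he⟩ := exists_measurableEmbedding_real Y
  filter_upwards [ae_invariant_of_measurable_invSigma (he.measurable.comp hπ.measurable_invSigma)]
    with p hp γ
  exact he.injective (hp γ)

lemma IsErgodicQuotient.congr {ρ' : Measure G} [SFinite ρ] [SFinite ρ'] [SFinite ν]
    (hπ : IsErgodicQuotient Γ ρ ν π) (h : ρ ≪ ρ') (h' : ρ' ≪ ρ) :
    IsErgodicQuotient Γ ρ' ν π where
  measurable_smul := hπ.measurable_smul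
  measurable := hπ.measurable
  equivariant := hπ.equivariant
  preimage_mem := invSigma_congr (Γ := Γ) (ν := ν) h h' ▸ hπ.preimage_mem
  exists_preimage A hA := by
    rw [← invSigma_congr (Γ := Γ) (ν := ν) h h'] at hA
    obtain ⟨B, hB, hAB⟩ := hπ.exists_preimage A hA
    exact ⟨B, hB, (Measure.AbsolutelyContinuous.prod h' .rfl).ae_le hAB⟩

lemma IsErgodicQuotient.eq_smul_one (hπ : IsErgodicQuotient Γ ρ ν π) (p : G × X) :
    π p = p.1 • π (1, p.2) := by
  rw [← hπ.equivariant, mul_one]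

/-- Invariance holds on almost every fibre; on one such fibre, equivariance expresses both sides as
translates by the same `g`, which cancels. -/
lemma IsErgodicQuotient.ae_smul_eq [StandardBorelSpace Y] [IsProbabilityMeasure ρ] [SFinite ν]
    (hπ : IsErgodicQuotient Γ ρ ν π) :
    ∀ᵐ x ∂ν, ∀ γ : Γ, (γ : G) • π (1, x) = π (1, γ • x) := by
  obtain ⟨g, hg⟩ := (Measure.ae_ae_of_ae_prod hπ.ae_invariant).exists
  filter_upwards [hg] with x hx γ
  have h := hx γ
  rw [hπ.eq_smul_one, hπ.eq_smul_one (g, x)] at h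
  simp only [star, mul_smul] at h
  rw [← smul_left_cancel g h, smul_inv_smul]

/-- An `𝔍`-measurable real function is almost surely a function of the quotient map. -/
lemma IsErgodicQuotient.exists_eq_comp (hπ : IsErgodicQuotient Γ ρ ν π) {φ : G × X → ℝ}
    (hφ : Measurable[invSigma Γ ρ ν] φ) {C : ℝ} (hC : 0 ≤ C) (hφC : ∀ p, |φ p| ≤ C) :
    ∃ ψ : Y → ℝ, Measurable ψ ∧ (∀ y, |ψ y| ≤ C) ∧ φ =ᵐ[ρ.prod ν] ψ ∘ π := by
  choose B hBm hB using fun q : ℚ => hπ.exists_preimage (φ ⁻¹' Set.Iio (q : ℝ))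
    (hφ measurableSet_Iio)
  classical
  -- The function is rebuilt from candidate sublevel sets. Off a null set the `B q` need not be
  -- nested or cover, so the infimum may be infinite.
  let ψ : Y → EReal := fun y => ⨅ q : ℚ, if y ∈ B q then ((q : ℝ) : EReal) else ⊤
  have hψ : Measurable ψ :=
    Measurable.iInf fun q => Measurable.ite (hBm q) measurable_const measurable_const
  refine ⟨fun y => clip C (ψ y).toReal, (measurable_clip C).comp hψ.ereal_toReal,
    fun y => abs_clip_le hC _, ?_⟩
  have h : ∀ᵐ p ∂(ρ.prod ν), ∀ q : ℚ, φ p < q ↔ π p ∈ B q :=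
    ae_all_iff.2 fun q => by
      filter_upwards [hB q] with p hp
      exact iff_of_eq hp
  filter_upwards [h] with p hp
  have he : ψ (π p) = (φ p : EReal) := by
    refine le_antisymm (le_of_forall_gt fun c hc => ?_) (le_iInf fun q => ?_)
    · obtain ⟨q, h1, h2⟩ := EReal.lt_iff_exists_rat_btwn.1 hc
      refine lt_of_le_of_lt (iInf_le _ q) ?_
      rw [if_pos ((hp q).1 (EReal.coe_lt_coe_iff.1 h1))]
      exact h2
    · split_ifs with hq
      · exact EReal.coe_le_coe_iff.2 ((hp q).2 hq).le
      · exact le_top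
  rw [Function.comp_apply, he, EReal.toReal_coe, clip_of_abs_le (hφC p)]

/-- Since `π (g, x) = g • π (1, x)`, the law of `π` is by definition a convolution. -/
lemma IsErgodicQuotient.measurePreserving [SFinite ρ] [IsProbabilityMeasure ν]
    (hπ : IsErgodicQuotient Γ ρ ν π) :
    MeasurePreserving π (ρ.prod ν) (actConv ρ (ν.map fun x => π (1, x))) := by
  have hm : Measurable fun x => π (1, x) := hπ.measurable.comp measurable_prodMk_left
  refine ⟨hπ.measurable, ?_⟩
  have h1 : ρ.prod (ν.map fun x => π (1, x))
      = (ρ.prod ν).map (Prod.map id fun x => π (1, x)) := by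
    conv_lhs => rw [← Measure.map_id (μ := ρ)]
    exact Measure.map_prod_map ρ ν measurable_id hm
  rw [actConv, h1, Measure.map_map hπ.measurable_smul (measurable_id.prodMap hm)]
  congr 1
  ext p
  exact hπ.eq_smul_one p

end Quotient

/-! ### Quotients are Poisson boundaries -/

section Boundary

variable {G X : Type*}
  [Group G] [TopologicalSpace G] [IsTopologicalGroup G] [T2Space G]
  [SecondCountableTopology G] [MeasurableSpace G] [BorelSpace G]
  {lam : Measure G} [lam.IsMulRightInvariant]
  {ρ : Measure G} [IsProbabilityMeasure ρ]
  {Γ : Subgroup G} [Countable Γ]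
  {μ : Measure Γ} [IsProbabilityMeasure μ]
  [MeasurableSpace X] [MulAction Γ X] {ν : Measure X}
  {Y : Type*} [MeasurableSpace Y] [StandardBorelSpace Y] [MulAction G Y] {π : G × X → Y}

/-- The map `x ↦ π (1, x)` is almost surely `Γ`-equivariant, so it pushes stationarity forward. -/
lemma IsErgodicQuotient.actConv_eq
    (hX : IsPoissonBoundary (Measure.count : Measure Γ) μ ν) (hπ : IsErgodicQuotient Γ ρ ν π) :
    actConv (μ.map Γ.subtype) (ν.map fun x => π (1, x)) = ν.map fun x => π (1, x) := by
  have := hX.isProbabilityMeasure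
  have hm : Measurable fun x => π (1, x) := hπ.measurable.comp measurable_prodMk_left
  have := Measure.isProbabilityMeasure_map (μ := ν) hm.aemeasurable
  ext B hB
  have hBm : Measurable fun g : G => (ν.map fun x => π (1, x)) ((fun y => g • y) ⁻¹' B) :=
    measurable_measure_prodMk_left (hπ.measurable_smul hB)
  rw [actConv_apply hπ.measurable_smul _ _ hB, 
    lintegral_map hBm (show Measurable Γ.subtype from measurable_subtype_coe)]
  conv_rhs => rw [Measure.map_apply hm hB, ← hX.invariant,
    actConv_apply hX.measurable_smul _ _ (hm hB)]
  refine lintegral_congr fun γ => ?_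
  have hγ : Measurable fun y : Y => (γ : G) • y := hπ.measurable_smul.comp measurable_prodMk_left
  change (ν.map fun x => π (1, x)) ((fun y : Y => (γ : G) • y) ⁻¹' B) = _
  rw [Measure.map_apply hm (hγ hB)]
  refine measure_congr ?_
  filter_upwards [hπ.ae_smul_eq] with x hx
  change ((γ : G) • π (1, x) ∈ B) = (π (1, γ • x) ∈ B)
  rw [hx γ]

/-- Every realization of the quotient by the ergodic components is a Poisson boundary. -/
lemma IsErgodicQuotient.isPoissonBoundary [StandardBorelSpace X] (hρ : ρ ≪ lam) (hρ' : lam ≪ ρ)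
    (hμ : Subsemigroup.closure {γ : Γ | μ {γ} ≠ 0} = ⊤)
    (hX : IsPoissonBoundary (Measure.count : Measure Γ) μ ν) (hπ : IsErgodicQuotient Γ ρ ν π) :
    IsPoissonBoundary lam (μ.map Γ.subtype) (ν.map fun x => π (1, x)) := by
  have := hX.isProbabilityMeasure
  have hm : Measurable fun x => π (1, x) := hπ.measurable.comp measurable_prodMk_left
  refine ⟨hπ.measurable_smul, Measure.isProbabilityMeasure_map hm.aemeasurable,
    hπ.actConv_eq hX, fun ρ₁ _ h₁ h₁' => ?_⟩
  have hπ₁ : IsErgodicQuotient Γ ρ₁ ν π := hπ.congr (hρ.trans h₁') (h₁.trans hρ')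
  obtain ⟨P, hP, hPr⟩ := exists_poisson_isometry h₁ h₁' hμ hX
  have hmp := hπ₁.measurePreserving
  set ν₁ := ν.map fun x => π (1, x) with hν₁
  let T : Lp ℝ ∞ (actConv ρ₁ ν₁) →ₗᵢ[ℝ] Lp ℝ ∞ (ρ₁.prod ν) :=
    Lp.compMeasurePreservingₗᵢ ℝ π hmp
  have hT : ∀ φ, T φ =ᵐ[ρ₁.prod ν] φ ∘ π := fun φ => Lp.coeFn_compMeasurePreserving φ hmp
  have hTm : ∀ φ, T φ ∈ lpMeas ℝ ℝ (invSigma Γ ρ₁ ν) ∞ (ρ₁.prod ν) := fun φ => by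
    rw [mem_lpMeas_iff_aestronglyMeasurable]
    exact ⟨φ ∘ π, ((Lp.stronglyMeasurable φ).measurable.comp
      hπ₁.measurable_invSigma).stronglyMeasurable, hT φ⟩
  let T' : Lp ℝ ∞ (actConv ρ₁ ν₁) →ₗᵢ[ℝ] lpMeas ℝ ℝ (invSigma Γ ρ₁ ν) ∞ (ρ₁.prod ν) :=
    { T.toLinearMap.codRestrict _ hTm with norm_map' := fun φ => T.norm_map φ }
  have hT' : ∀ φ, ((T' φ : lpMeas ℝ ℝ (invSigma Γ ρ₁ ν) ∞ (ρ₁.prod ν)) : Lp ℝ ∞ (ρ₁.prod ν))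
    = T φ := fun φ => rfl
  refine ⟨P.comp T', fun φ => ?_, ?_⟩
  · filter_upwards [hP (T' φ), ae_fiber_eq h₁' (hT φ)] with g h1 h2
    change P (T' φ) g = _
    have h3 : ∫ y, φ (g • y) ∂ν₁ = ∫ x, φ (g • π (1, x)) ∂ν :=
      integral_map hm.aemeasurable ((Lp.stronglyMeasurable φ).measurable.comp
        (hπ.measurable_smul.comp measurable_prodMk_left)).aestronglyMeasurable
    rw [h1, hT', integral_congr_ae h2, h3]
    simp only [Function.comp_apply, hπ.eq_smul_one (g, _)]
  · refine Set.Subset.antisymm ?_ ?_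
    · rintro _ ⟨φ, rfl⟩
      rw [← hPr]
      exact ⟨T' φ, rfl⟩
    · rw [← hPr]
      rintro _ ⟨φ, rfl⟩
      -- Surjectivity: each `𝔍`-measurable class factors through `π`.
      obtain ⟨φ', hφm, hφb, hφi, hφe⟩ := exists_bounded_invariant_rep φ
      obtain ⟨ψ, hψm, hψb, hψe⟩ := hπ₁.exists_eq_comp
        (measurable_invSigma_of_ae_invariant hφm hφi) (norm_nonneg φ) hφb
      have hL : MemLp ψ ∞ (actConv ρ₁ ν₁) :=
        memLp_top_of_bound hψm.aestronglyMeasurable _ (ae_of_all _ hψb)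
      refine ⟨hL.toLp ψ, ?_⟩
      change P (T' (hL.toLp ψ)) = P φ
      congr 1
      refine Subtype.ext ?_
      rw [hT']
      ext1
      exact ((hT _).trans (hmp.quasiMeasurePreserving.ae_eq_comp hL.coeFn_toLp)).trans
        (hψe.symm.trans hφe.symm)

end Boundary

/-! ### Continuity of averaged translates -/

section Translate

variable {G : Type*}
  [Group G] [TopologicalSpace G] [IsTopologicalGroup G] [T2Space G] [LocallyCompactSpace G]
  [SecondCountableTopology G] [MeasurableSpace G] [BorelSpace G]
  {lam : Measure G} [lam.IsMulRightInvariant] [IsFiniteMeasureOnCompacts lam]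

-- Right invariance moves the translation from the merely measurable `u` to the continuous `w`.
open scoped Pointwise in
lemma continuous_integral_translate_of_hasCompactSupport {w u : G → ℝ} (hw : Continuous w)
    (hwc : HasCompactSupport w) (hu : Measurable u) {C : ℝ} (huC : ∀ g, |u g| ≤ C) :
    Continuous fun g => ∫ h, w h * u (h * g) ∂lam := by
  have he : ∀ g, ∫ h, w h * u (h * g) ∂lam = ∫ h, u h * w (h * g⁻¹) ∂lam := by
    intro g
    rw [← integral_mul_right_eq_self (fun h => u h * w (h * g⁻¹)) g]
    simp only [mul_inv_cancel_right, mul_comm]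
  simp only [he]
  refine continuous_iff_continuousAt.2 fun g₀ => ?_
  obtain ⟨s, hs, hsg⟩ := exists_compact_mem_nhds g₀
  refine ContinuousOn.continuousAt (s := s) ?_ hsg
  have hk : IsCompact (tsupport w * s) := hwc.isCompact.mul hs
  refine continuousOn_integral_bilinear_of_locally_integrable_of_compact_support
    (ContinuousLinearMap.mul ℝ ℝ) hk (f := fun g h => w (h * g⁻¹)) ?_ ?_ ?_
  · exact (hw.comp (continuous_snd.mul continuous_fst.inv)).continuousOn
  · intro g h hg hh
    by_contra hne
    refine hh ⟨h * g⁻¹, subset_tsupport _ hne, g, hg, by simp⟩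
  · exact Measure.integrableOn_of_bounded hk.measure_lt_top.ne hu.aestronglyMeasurable
      (ae_of_all _ huC)

/-- Approximating `w` in `L¹` by compactly supported continuous functions gives uniform convergence,
because `u` is bounded. -/
lemma continuous_integral_translate {w u : G → ℝ} (hw : Integrable w lam) (hu : Measurable u)
    {C : ℝ} (huC : ∀ g, |u g| ≤ C) : Continuous fun g => ∫ h, w h * u (h * g) ∂lam := by
  have hC : 0 ≤ C := (abs_nonneg _).trans (huC 1)
  have hi : ∀ {v : G → ℝ}, Integrable v lam → ∀ g, Integrable (fun h => v h * u (h * g)) lam :=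
    fun hv g => hv.mul_bdd (hu.comp (measurable_mul_const g)).aestronglyMeasurable
      (ae_of_all _ fun h => huC _)
  refine continuous_of_uniform_approx_of_continuous fun U hU => ?_
  obtain ⟨ε, hε, hεU⟩ := Metric.mem_uniformity_dist.1 hU
  obtain ⟨v, hvc, hv, hvcont, hvi⟩ :=
    hw.exists_hasCompactSupport_integral_sub_le (ε := ε / (C + 1) / 2) (by positivity)
  refine ⟨_, continuous_integral_translate_of_hasCompactSupport (lam := lam) hvcont hvc hu huC,
    fun g => hεU ?_⟩
  rw [Real.dist_eq, ← integral_sub (hi hw g) (hi hvi g)]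
  calc |∫ h, (w h * u (h * g) - v h * u (h * g)) ∂lam|
      ≤ ∫ h, ‖w h - v h‖ * C ∂lam := by
        rw [← Real.norm_eq_abs]
        refine norm_integral_le_of_norm_le ((hw.sub hvi).norm.mul_const C) (ae_of_all _ fun h => ?_)
        rw [← sub_mul, norm_mul]
        exact mul_le_mul_of_nonneg_left (huC _) (norm_nonneg _)
    _ = (∫ h, ‖w h - v h‖ ∂lam) * C := integral_mul_const _ _
    _ ≤ ε / (C + 1) / 2 * (C + 1) := by gcongr; linarith
    _ < ε := by
        have : ε / (C + 1) / 2 * (C + 1) = ε / 2 := by field_simp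
        linarith

lemma continuous_integral_translate_of_absolutelyContinuous {ρ : Measure G}
    [IsProbabilityMeasure ρ] (hρ : ρ ≪ lam) {w u : G → ℝ} (hw : Integrable w ρ) (hu : Measurable u)
    {C : ℝ} (huC : ∀ g, |u g| ≤ C) : Continuous fun g => ∫ h, w h * u (h * g) ∂ρ := by
  have h1 : Integrable (fun h => (ρ.rnDeriv lam h).toReal * w h) lam :=
    (integrable_rnDeriv_smul_iff hρ).2 hw
  convert continuous_integral_translate h1 hu huC using 2 with g
  rw [← integral_rnDeriv_smul hρ]
  simp only [smul_eq_mul, mul_assoc]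

end Translate

/-! ### A Polish `G`-space of continuous functions -/

/-- The space of continuous maps from `G` to `ℝ^(ℕ × ℕ)`, with `G` acting by right translations of
the variable. -/
def TranslationSpace (G : Type*) [TopologicalSpace G] : Type _ := C(G, ℕ → ℕ → ℝ)

namespace TranslationSpace

variable {G : Type*}
  [Group G] [TopologicalSpace G] [IsTopologicalGroup G] [T2Space G] [LocallyCompactSpace G]
  [SecondCountableTopology G]

instance : TopologicalSpace (TranslationSpace G) := inferInstanceAs (TopologicalSpace C(G, _))

instance : PolishSpace (TranslationSpace G) := inferInstanceAs (PolishSpace C(G, ℕ → ℕ → ℝ))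

instance : MeasurableSpace (TranslationSpace G) := borel _

instance : BorelSpace (TranslationSpace G) := ⟨rfl⟩

instance : FunLike (TranslationSpace G) G (ℕ → ℕ → ℝ) :=
  inferInstanceAs (FunLike C(G, ℕ → ℕ → ℝ) G _)

instance : MulAction G (TranslationSpace G) where
  smul g F := ContinuousMap.comp (F : C(G, ℕ → ℕ → ℝ)) ⟨fun h => h * g, continuous_mul_const g⟩
  one_smul F := ContinuousMap.ext fun h => congrArg F (mul_one h)
  mul_smul a b F := ContinuousMap.ext fun h => congrArg F (mul_assoc h a b).symm

lemma continuous_eval_const (h : G) : Continuous fun F : TranslationSpace G => F h :=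
  ContinuousEvalConst.continuous_eval_const (F := C(G, ℕ → ℕ → ℝ)) h

lemma continuous_smul : Continuous fun p : G × TranslationSpace G => p.1 • p.2 := by
  refine ContinuousMap.continuous_of_continuous_uncurry (Y := G) (Z := ℕ → ℕ → ℝ) _ ?_
  have h : Continuous fun q : C(G, ℕ → ℕ → ℝ) × G => q.1 q.2 := ContinuousEval.continuous_eval
  exact h.comp (((continuous_snd.comp continuous_fst)).prodMk
    (continuous_snd.mul (continuous_fst.comp continuous_fst)))

lemma measurable_smul [MeasurableSpace G] [BorelSpace G] :
    Measurable fun p : G × TranslationSpace G => p.1 • p.2 :=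
  continuous_smul.measurable

/-- Evaluation along a dense sequence is a continuous injection of a Polish space, hence a Borel
embedding. -/
lemma measurable_of_eval {Ω : Type*} [MeasurableSpace Ω] {f : Ω → TranslationSpace G}
    (hf : ∀ g, Measurable fun ω => f ω g) : Measurable f := by
  let E : TranslationSpace G → ℕ → ℕ → ℕ → ℝ := fun F k => F (TopologicalSpace.denseSeq G k)
  have hE : Continuous E := continuous_pi fun k => continuous_eval_const _
  have hEi : Function.Injective E := by
    intro F F' h
    refine DFunLike.coe_injective ?_
    exact Continuous.ext_on (TopologicalSpace.denseRange_denseSeq G)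
      (ContinuousMap.continuous (F : C(G, ℕ → ℕ → ℝ)))
      (ContinuousMap.continuous (F' : C(G, ℕ → ℕ → ℝ)))
      (by rintro _ ⟨k, rfl⟩; exact congrFun h k)
  refine (hE.measurableEmbedding hEi).measurable_comp_iff.1 ?_
  exact measurable_pi_lambda _ fun k => hf _

end TranslationSpace

/-! ### Recovering invariant sets from averages -/

section Realization

variable {G X : Type*} [Group G] [MeasurableSpace G] {Γ : Subgroup G} [MeasurableSpace X]
  [MulAction Γ X] {ρ : Measure G} {ν : Measure X}

/-- A realization of the quotient as a standard Borel space can be moved to the lowest universe. -/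
lemma IsErgodicQuotient.exists_small {Z : Type*} [MeasurableSpace Z] [StandardBorelSpace Z]
    [MulAction G Z] {π : G × X → Z} (hπ : IsErgodicQuotient Γ ρ ν π) :
    ∃ (Y : Type) (_ : MeasurableSpace Y) (_ : StandardBorelSpace Y) (_ : MulAction G Y)
      (π : G × X → Y), IsErgodicQuotient Γ ρ ν π := by
  obtain ⟨e, he⟩ := exists_measurableEmbedding_real Z
  let E : Z ≃ᵐ Set.range e := he.equivRange
  let _ : MulAction G (Set.range e) := E.symm.toEquiv.mulAction G
  have hs : ∀ (g : G) (y : Set.range e), g • y = E (g • E.symm y) := fun g y => rfl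
  refine ⟨Set.range e, inferInstance, he.measurableSet_range.standardBorel, inferInstance,
    E ∘ π, ?_, E.measurable.comp hπ.measurable, ?_, ?_, ?_⟩
  · simp only [hs]
    exact E.measurable.comp (hπ.measurable_smul.comp
      (measurable_fst.prodMk (E.symm.measurable.comp measurable_snd)))
  · intro g₀ g x
    simp [hs, hπ.equivariant g₀ g x]
  · exact fun B hB => hπ.preimage_mem _ (E.measurable hB)
  · intro A hA
    obtain ⟨B, hB, hAB⟩ := hπ.exists_preimage A hA
    refine ⟨E.symm ⁻¹' B, E.symm.measurable hB, hAB.trans (ae_of_all _ fun p => ?_)⟩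
    change (π p ∈ B) = (E.symm (E (π p)) ∈ B)
    rw [E.symm_apply_apply]

lemma measurable_integral_mul_of_denseSeq {G Ω : Type*} [MeasurableSpace G] {ρ : Measure G}
    [MeasurableSpace Ω]
    [TopologicalSpace.SeparableSpace (Lp ℝ 1 ρ)] {φ : Ω → G → ℝ}
    (hφ : ∀ ω, Measurable (φ ω)) {C : ℝ} (hφC : ∀ ω g, |φ ω g| ≤ C)
    (h : ∀ n, Measurable fun ω =>
      ∫ x, TopologicalSpace.denseSeq (Lp ℝ 1 ρ) n x * φ ω x ∂ρ) (q : Lp ℝ 1 ρ) :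
    Measurable fun ω => ∫ x, q x * φ ω x ∂ρ := by
  obtain ⟨Λ, hΛ⟩ := exists_pairing (ν := ρ) hφ hφC
  simp only [← hΛ] at h ⊢
  obtain ⟨u, hu, huq⟩ := mem_closure_iff_seq_limit.1
    (TopologicalSpace.denseRange_denseSeq (Lp ℝ 1 ρ) q)
  refine measurable_of_tendsto_metrizable (f := fun n ω => Λ ω (u n)) (fun n => ?_)
    (tendsto_pi_nhds.2 fun ω => ((Λ ω).continuous.tendsto q).comp huq)
  obtain ⟨k, hk⟩ := hu n
  rw [← hk]
  exact h k

end Realization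

section Recover

variable {G X : Type*}
  [Group G] [TopologicalSpace G] [IsTopologicalGroup G] [T2Space G] [LocallyCompactSpace G]
  [SecondCountableTopology G] [MeasurableSpace G] [BorelSpace G]
  {lam : Measure G} [lam.IsMulRightInvariant] [IsFiniteMeasureOnCompacts lam]
  {ρ : Measure G} [IsProbabilityMeasure ρ]
  [MeasurableSpace X] {ν : Measure X} [IsProbabilityMeasure ν]

lemma quasiMeasurePreserving_mul_left_prod (hρ : ρ ≪ lam) (hρ' : lam ≪ ρ) (g : G) :
    Measure.QuasiMeasurePreserving (fun p : G × X => (g * p.1, p.2)) (ρ.prod ν) (ρ.prod ν) := by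
  have h1 : ρ.map (fun h : G => g * h) ≪ ρ :=
    ((hρ.map (measurable_const_mul g)).trans
      (quasiMeasurePreserving_mul_left lam g).absolutelyContinuous).trans hρ'
  have h2 : (ρ.prod ν).map (fun p : G × X => (g * p.1, p.2))
      = (ρ.map (fun h : G => g * h)).prod (ν.map id) :=
    (Measure.map_prod_map ρ ν (measurable_const_mul g) measurable_id).symm
  refine ⟨(measurable_fst.const_mul g).prodMk measurable_snd, ?_⟩
  rw [h2, Measure.map_id]
  exact h1.prod .rfl

/-- A set whose averaged translates are measurable functions of an equivariant map `π` is, up to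
a null set, a preimage under `π`. -/
lemma exists_preimage_of_measurable_averages (hρ : ρ ≪ lam) (hρ' : lam ≪ ρ)
    {Y : Type*} [MeasurableSpace Y] [MulAction G Y] {π : G × X → Y}
    (hsm : ∀ g : G, Measurable fun y : Y => g • y) (hπ : Measurable π)
    (he : ∀ (g₀ g : G) (x : X), π (g₀ * g, x) = g₀ • π (g, x)) {A : Set (G × X)}
    (hA : MeasurableSet A)
    (h : ∀ q : Lp ℝ 1 ρ, Measurable[MeasurableSpace.comap π inferInstance] fun p : G × X =>
      ∫ k, q k * A.indicator (fun _ => (1 : ℝ)) (k * p.1, p.2) ∂ρ) :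
    ∃ B : Set Y, MeasurableSet B ∧ A =ᵐ[ρ.prod ν] π ⁻¹' B := by
  have h1 : Measurable (A.indicator fun _ => (1 : ℝ)) := measurable_const.indicator hA
  have hmap : Measurable fun r : (G × X) × G => (r.2 * r.1.1, r.1.2) :=
    (measurable_snd.mul (measurable_fst.comp measurable_fst)).prodMk
      (measurable_snd.comp measurable_fst)
  obtain ⟨D, hD, -, hDe⟩ := @exists_jointly_measurable_version (G × X) G
    (MeasurableSpace.comap π inferInstance) _ _ ρ _
    (fun p k => A.indicator (fun _ => (1 : ℝ)) (k * p.1, p.2))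
    (fun p => (h1.comp hmap).comp measurable_prodMk_left) 1 zero_le_one
    (fun p k => by by_cases hk : (k * p.1, p.2) ∈ A <;> simp [hk]) h
  have hle : MeasurableSpace.comap π inferInstance ≤ (inferInstance : MeasurableSpace (G × X)) :=
    hπ.comap_le
  have hD' : Measurable D := hD.mono (sup_le_sup (MeasurableSpace.comap_mono hle) le_rfl) le_rfl
  have hae : ∀ᵐ k ∂ρ, ∀ᵐ p ∂(ρ.prod ν), D (p, k) = A.indicator (fun _ => (1 : ℝ)) (k * p.1, p.2) :=
    (Measure.ae_ae_comm (μ := ρ.prod ν) (ν := ρ) (measurableSet_eq_fun hD' (h1.comp hmap))).1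
      (ae_of_all _ hDe)
  -- One generic `k` makes the translate of `A` by `k` measurable for `π`; equivariance then undoes
  -- the translation.
  obtain ⟨k, hk⟩ := hae.exists
  have hDk : Measurable[MeasurableSpace.comap π inferInstance] fun p => D (p, k) :=
    hD.comp (@measurable_prodMk_right _ _ (MeasurableSpace.comap π inferInstance) _ k)
  obtain ⟨B, hB, hBD⟩ := hDk (measurableSet_singleton (1 : ℝ))
  refine ⟨(fun y => k⁻¹ • y) ⁻¹' B, hsm _ hB, ?_⟩
  filter_upwards [(quasiMeasurePreserving_mul_left_prod hρ hρ' k⁻¹).ae hk] with p hp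
  change (p ∈ A) = (k⁻¹ • π (p.1, p.2) ∈ B)
  rw [← he]
  have h2 : (k⁻¹ * p.1, p.2) ∈ π ⁻¹' B ↔ D ((k⁻¹ * p.1, p.2), k) = 1 := by rw [hBD]; rfl
  rw [Set.mem_preimage] at h2
  rw [eq_iff_iff, h2, hp]
  by_cases hpA : p ∈ A <;> simp [hpA]

end Recover

/-! ### Construction of the quotient -/

section Existence

variable {G X : Type*}
  [Group G] [TopologicalSpace G] [IsTopologicalGroup G] [T2Space G] [LocallyCompactSpace G]
  [SecondCountableTopology G] [MeasurableSpace G] [BorelSpace G]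
  {lam : Measure G} [lam.IsMulRightInvariant] [IsFiniteMeasureOnCompacts lam]
  {ρ : Measure G} [IsProbabilityMeasure ρ]
  {Γ : Subgroup G} [Countable Γ]
  [MeasurableSpace X] [MulAction Γ X] {ν : Measure X} [IsProbabilityMeasure ν]

/-- The sets of `𝔍` are, in measure, limits of sets from a countable subfamily. -/
lemma exists_dense_invariant_sets [MeasurableSpace.CountablyGenerated X] (Γ : Subgroup G)
    [MulAction Γ X] (ρ : Measure G) [IsProbabilityMeasure ρ] (ν : Measure X)
    [IsProbabilityMeasure ν] :
    ∃ A : ℕ → Set (G × X), (∀ m, MeasurableSet[invSigma Γ ρ ν] (A m)) ∧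
      ∀ 𝔎 : MeasurableSpace (G × X), 𝔎 ≤ Prod.instMeasurableSpace →
        (∀ m, ∃ B, MeasurableSet[𝔎] B ∧ A m =ᵐ[ρ.prod ν] B) →
        ∀ A, MeasurableSet[invSigma Γ ρ ν] A → ∃ B, MeasurableSet[𝔎] B ∧ A =ᵐ[ρ.prod ν] B := by
  have : Fact ((1 : ℝ≥0∞) ≠ ∞) := ⟨ENNReal.one_ne_top⟩
  let ind : {A : Set (G × X) // MeasurableSet[invSigma Γ ρ ν] A} → Lp ℝ 1 (ρ.prod ν) := fun A =>
    indicatorConstLp 1 A.2.1 (measure_ne_top _ _) (1 : ℝ)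
  have hind : ∀ A, ind A =ᵐ[ρ.prod ν] A.1.indicator fun _ => (1 : ℝ) := fun A =>
    indicatorConstLp_coeFn
  have : Nonempty (Set.range ind) := ⟨⟨_, ⟨∅, @MeasurableSet.empty _ (invSigma Γ ρ ν)⟩, rfl⟩⟩
  -- Indicators of sets in `𝔍` form a subset of the separable metric space `L¹`, so a sequence of
  -- them is dense.
  choose A hA using fun m => (TopologicalSpace.denseSeq (Set.range ind) m).2
  refine ⟨fun m => (A m).1, fun m => (A m).2, fun 𝔎 h𝔎 h C hC => ?_⟩
  have hcl : IsClosed {f : Lp ℝ 1 (ρ.prod ν) | AEStronglyMeasurable[𝔎] f (ρ.prod ν)} :=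
    isClosed_aestronglyMeasurable h𝔎
  have hcl' := hcl.preimage (continuous_subtype_val (p := fun f => f ∈ Set.range ind))
  have hmem : AEStronglyMeasurable[𝔎] (ind ⟨C, hC⟩) (ρ.prod ν) := by
    refine (TopologicalSpace.denseRange_denseSeq (Set.range ind)).induction_on
      (p := fun f => AEStronglyMeasurable[𝔎] (f : Lp ℝ 1 (ρ.prod ν)) (ρ.prod ν))
      ⟨ind ⟨C, hC⟩, _, rfl⟩ hcl' fun m => ?_
    obtain ⟨B, hB, hAB⟩ := h m
    refine ⟨B.indicator fun _ => 1, (@measurable_const _ _ _ 𝔎 1).indicator hB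
      |>.stronglyMeasurable, ?_⟩
    rw [← hA m]
    filter_upwards [hind (A m), hAB] with p h1 h2
    have h3 : p ∈ (A m).1 ↔ p ∈ B := iff_of_eq h2
    rw [h1]
    by_cases hp : p ∈ B <;> simp [hp, h3]
  obtain ⟨θ, hθ, hθe⟩ := hmem
  refine ⟨θ ⁻¹' {1}, hθ.measurable (measurableSet_singleton 1), ?_⟩
  filter_upwards [hθe, hind ⟨C, hC⟩] with p h1 h2
  change (p ∈ C) = (θ p = 1)
  rw [← h1, h2]
  by_cases hp : p ∈ C <;> simp [hp]

/-- The quotient of `G × X` by the `Γ`-ergodic components exists as a standard Borel `G`-space. -/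
lemma exists_isErgodicQuotient [StandardBorelSpace X] (hρ : ρ ≪ lam) (hρ' : lam ≪ ρ)
    (hsm : ∀ γ : Γ, Measurable fun x : X => γ • x) :
    ∃ (Y : Type) (_ : MeasurableSpace Y) (_ : StandardBorelSpace Y) (_ : MulAction G Y)
      (π : G × X → Y), IsErgodicQuotient Γ ρ ν π := by
  obtain ⟨A, hA, hAd⟩ := exists_dense_invariant_sets Γ ρ ν
  let u : ℕ → G × X → ℝ := fun m => (A m).indicator fun _ => 1
  have hu : ∀ m, Measurable (u m) := fun m => measurable_const.indicator (hA m).1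
  have hub : ∀ m p, |u m p| ≤ 1 := fun m p => by by_cases hp : p ∈ A m <;> simp [u, hp]
  have : Fact ((1 : ℝ≥0∞) ≠ ∞) := ⟨ENNReal.one_ne_top⟩
  let q : ℕ → Lp ℝ 1 ρ := TopologicalSpace.denseSeq (Lp ℝ 1 ρ)
  have hcont : ∀ x, Continuous fun g => fun m n => ∫ h, q n h * u m (h * g, x) ∂ρ := fun x =>
    continuous_pi fun m => continuous_pi fun n =>
      continuous_integral_translate_of_absolutelyContinuous hρ (L1.integrable_coeFn (q n))
        (u := fun k => u m (k, x)) ((hu m).comp measurable_prodMk_right) fun k => hub m _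
  let c : X → TranslationSpace G := fun x =>
    (⟨fun g => fun m n => ∫ h, q n h * u m (h * g, x) ∂ρ, hcont x⟩ : C(G, ℕ → ℕ → ℝ))
  let π : G × X → TranslationSpace G := fun p => p.1 • c p.2
  have hπ : ∀ p k m n, π p k m n = ∫ h, q n h * u m (h * (k * p.1), p.2) ∂ρ :=
    fun p k m n => rfl
  have hπm : Measurable π := by
    refine TranslationSpace.measurable_of_eval fun k => ?_
    refine measurable_pi_lambda _ fun m => measurable_pi_lambda _ fun n => ?_
    simp only [hπ]
    have hmap : Measurable fun r : (G × X) × G => (r.2 * (k * r.1.1), r.1.2) :=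
      (measurable_snd.mul ((measurable_fst.comp measurable_fst).const_mul k)).prodMk
        (measurable_snd.comp measurable_fst)
    have h1 : Measurable fun r : (G × X) × G => q n r.2 * u m (r.2 * (k * r.1.1), r.1.2) :=
      ((Lp.stronglyMeasurable (q n)).measurable.comp measurable_snd).mul ((hu m).comp hmap)
    exact h1.stronglyMeasurable.integral_prod_right'.measurable
  have hπe : ∀ (g₀ g : G) (x : X), π (g₀ * g, x) = g₀ • π (g, x) := fun g₀ g x => mul_smul _ _ _
  have hinv : ∀ᵐ p ∂(ρ.prod ν), ∀ γ : Γ, π (star Γ γ p) = π p := by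
    have hstar : ∀ γ : Γ, Measurable (star (X := X) Γ γ) := fun γ =>
      (measurable_fst.mul_const _).prodMk ((hsm γ).comp measurable_snd)
    have h1 : ∀ᵐ x ∂ν, ∀ (γ : Γ) (m : ℕ), ∀ᵐ g ∂ρ, u m (star Γ γ (g, x)) = u m (g, x) := by
      refine ae_all_iff.2 fun γ => ae_all_iff.2 fun m => ?_
      refine (Measure.ae_ae_comm (μ := ρ) (ν := ν) (measurableSet_eq_fun
        ((hu m).comp (hstar γ)) (hu m))).1 ?_
      refine Measure.ae_ae_of_ae_prod (p := fun p => u m (star Γ γ p) = u m p) ?_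
      filter_upwards [(hA m).2] with p hp
      have := hp γ
      by_cases hpA : p ∈ A m <;> simp_all [u]
    have h2 : ∀ᵐ x ∂ν, ∀ g (γ : Γ), π (star Γ γ (g, x)) = π (g, x) := by
      filter_upwards [h1] with x hx g γ
      refine DFunLike.coe_injective (funext fun k => funext fun m => funext fun n => ?_)
      rw [hπ, hπ]
      refine integral_congr_ae ?_
      -- Right translation by `k * g` preserves `lam`-null sets, so for generic `x` invariance holds
      -- at every `g` and `k`.
      have h3 := (measurePreserving_mul_right lam (k * g)).quasiMeasurePreserving.ae
        (hρ'.ae_le (hx γ m))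
      filter_upwards [hρ.ae_le h3] with h hh
      simp only [star] at hh ⊢
      rw [← hh]
      simp only [mul_assoc]
    have h3 := Measure.quasiMeasurePreserving_snd (μ := ρ) (ν := ν) |>.ae h2
    filter_upwards [h3] with p hp γ using hp p.1 γ
  refine IsErgodicQuotient.exists_small (π := π) ⟨TranslationSpace.measurable_smul, hπm, hπe,
    fun B hB => ⟨hπm hB, ?_⟩, fun C hC => ?_⟩
  · filter_upwards [hinv] with p hp γ
    rw [Set.mem_preimage, Set.mem_preimage, hp γ]
  · have hle : MeasurableSpace.comap π inferInstance ≤ Prod.instMeasurableSpace := hπm.comap_le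
    have havg : ∀ m (r : Lp ℝ 1 ρ), Measurable[MeasurableSpace.comap π inferInstance]
        fun p : G × X => ∫ k, r k * u m (k * p.1, p.2) ∂ρ := by
      intro m
      refine @measurable_integral_mul_of_denseSeq G (G × X) _ ρ
        (MeasurableSpace.comap π inferInstance) _ (fun p k => u m (k * p.1, p.2))
        (fun p => (hu m).comp ((measurable_id.mul_const p.1).prodMk measurable_const)) 1
        (fun p k => hub m _) fun n => ?_
      -- Evaluation at `1` returns the averages against the dense sequence; all others are limits of
      -- these.
      have h1 : Measurable fun F : TranslationSpace G => F 1 m n :=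
        ((measurable_pi_apply n).comp (measurable_pi_apply m)).comp
          (TranslationSpace.continuous_eval_const 1).measurable
      have h2 := h1.comp (comap_measurable π)
      simpa only [Function.comp_def, hπ, one_mul] using h2
    obtain ⟨_, ⟨B, hB, rfl⟩, hCB⟩ := hAd (MeasurableSpace.comap π inferInstance) hle
      (fun m => by
        obtain ⟨B, hB, hAB⟩ := exists_preimage_of_measurable_averages (ν := ν) hρ hρ'
          (fun g => TranslationSpace.measurable_smul.comp measurable_prodMk_left) hπm hπe
          (hA m).1 (havg m)
        exact ⟨π ⁻¹' B, ⟨B, hB, rfl⟩, hAB⟩) C hC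
    exact ⟨B, hB, hCB⟩

end Existence

end GammaBoundary

end

theorem mainTheorem2 {G X : Type*}
    [Group G] [TopologicalSpace G] [IsTopologicalGroup G] [T2Space G] [LocallyCompactSpace G]
    [SecondCountableTopology G] [MeasurableSpace G] [BorelSpace G]
    (lam : Measure G) [lam.IsMulRightInvariant] [IsFiniteMeasureOnCompacts lam]
    [lam.IsOpenPosMeasure]
    (ρ : Measure G) [IsProbabilityMeasure ρ] (hρ : ρ ≪ lam) (hρ' : lam ≪ ρ)
    (Γ : Subgroup G) [Countable Γ]
    (μ : Measure Γ) [IsProbabilityMeasure μ]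
    (hμ : Subsemigroup.closure {γ : Γ | μ {γ} ≠ 0} = ⊤)
    [MeasurableSpace X] [StandardBorelSpace X] [MulAction Γ X]
    (ν : Measure X)
    (hX : GammaBoundary.IsPoissonBoundary (Measure.count : Measure Γ) μ ν) :
    -- every harmonic function is the transform of a bounded invariant function
    (∀ f ∈ GammaBoundary.harmonic lam (μ.map Γ.subtype),
      ∃ φ : G × X → ℝ, Measurable φ ∧ (∃ C : ℝ, ∀ p, |φ p| ≤ C) ∧
        (∀ᵐ p ∂(ρ.prod ν), ∀ γ : Γ, φ (GammaBoundary.star Γ γ p) = φ p) ∧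
        f =ᵐ[lam] fun g => ∫ x, φ (g, x) ∂ν) ∧
    -- the transform is an isometry of the space of invariant functions onto the harmonic functions
    (∃ P : lpMeas ℝ ℝ (GammaBoundary.invSigma Γ ρ ν) ∞ (ρ.prod ν) →ₗᵢ[ℝ] Lp ℝ ∞ lam,
      (∀ φ : lpMeas ℝ ℝ (GammaBoundary.invSigma Γ ρ ν) ∞ (ρ.prod ν),
        P φ =ᵐ[lam] fun g => ∫ x, (φ : Lp ℝ ∞ (ρ.prod ν)) (g, x) ∂ν) ∧
      Set.range P = GammaBoundary.harmonic lam (μ.map Γ.subtype)) ∧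
    -- the quotient by the ergodic components exists as a standard Borel `G`-space
    (∃ (Y : Type) (_ : MeasurableSpace Y) (_ : StandardBorelSpace Y) (_ : MulAction G Y)
      (π : G × X → Y), GammaBoundary.IsErgodicQuotient Γ ρ ν π) ∧
    -- and each realization of it is a Poisson boundary of `(G, μ)`
    (∀ (Y : Type*) [MeasurableSpace Y] [StandardBorelSpace Y] [MulAction G Y] (π : G × X → Y),
      GammaBoundary.IsErgodicQuotient Γ ρ ν π →
        GammaBoundary.IsPoissonBoundary lam (μ.map Γ.subtype) (ν.map fun x => π (1, x))) := by
  obtain ⟨P, hP, hPr⟩ := GammaBoundary.exists_poisson_isometry hρ hρ' hμ hX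
  have := hX.isProbabilityMeasure
  refine ⟨fun f hf => ?_, ⟨P, hP, hPr⟩,
    GammaBoundary.exists_isErgodicQuotient hρ hρ' hX.measurable_const_smul,
    fun Y _ _ _ π hπ => hπ.isPoissonBoundary hρ hρ' hμ hX⟩
  obtain ⟨φ, hφ, hb, hi, he⟩ := GammaBoundary.exists_invariant_of_harmonic (ρ := ρ) hμ hX hf
  exact ⟨φ, hφ, ⟨_, hb⟩, hi, he⟩
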